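/- Let $0\le r\le n$ and $p,q\ge 0$ be integers, let $a_{1:p}=(a_1,\dots,a_p)$ and $b_{1:q}=(b_1,\dots,b_q)$ be complex parameters, and let $X=\mathrm{diag}(x_1,\dots,x_n)$, $Y=\mathrm{diag}(y_1,\dots,y_n)$, where $y_1,\dots,y_n\in\mathbb{C}$, $x_1>\cdots>x_r$ are nonzero real numbers and $x_{r+1}=\cdots=x_n=0$. For $\alpha>0$ let $${}_pF_q^{(\alpha)}(a_{1:p};b_{1:q};X,Y)=\sum_{k=0}^\infty\frac1{k!}\sum_{\kappa\vdash k,\ \ell(\kappa)\le n}\frac{(a_1)^{(\alpha)}_\kappa\cdots(a_p)^{(\alpha)}_\kappa}{(b_1)^{(\alpha)}_\kappa\cdots(b_q)^{(\alpha)}_\kappa}\,\frac{C^{(\alpha)}_\kappa(x_1,\dots,x_n)\,C^{(\alpha)}_\kappa(y_1,\dots,y_n)}{C^{(\alpha)}_\kappa(1,\dots,1)},$$ where $C_\kappa^{(\alpha)}$ are the Jack polynomials in $n$ variables normalized by $(x_1+\cdots+x_n)^k=\sum_{\kappa\vdash k,\ \ell(\kappa)\le n}C_\kappa^{(\alpha)}(x_1,\dots,x_n)$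 and $(a)^{(\alpha)}_\kappa=\prod_{i}\prod_{m=0}^{\kappa_i-1}\bigl(a-\tfrac{i-1}{\alpha}+m\bigr)$; let ${}_pF_q(a_{1:p};b_{1:q};z)$ be the classical hypergeometric series in one variable. Assume that no $b_i$ is an integer $\le n-1$ and that no $a_j$ belongs to $\{1,\dots,n-1\}$. Assume that one of the following holds: $p\le q$; or $p=q+1$ and $|x_i y_s|<1$ for all $i,s$; or some $a_j$ is a non-positive integer (so that the series terminates). Let $\mathrm{C}$ be a closed piecewise $C^1$ contour that encloses $y_1,\dots,y_n$ counter-clockwise (it avoids them and has winding number $1$ about each of them), where, if $p=q+1$ and the series does not terminate, $\mathrm{C}$ lies in the region $|x_i z|<1$ $(1\le i\le r)$ in which the scalar series below converge. Then the series over $k$ defining ${}_pF_q^{(1)}(a_{1:p};b_{1:q};X,Y)$ converges absolutely, and $${}_pF_q^{(1)}(a_{1:p};b_{1:q};X,Y)=\frac{K(a_{1:p},b_{1:q})}{\prod_{1\le i<j\le r}(x_i-x_j)\,\prod_{j=1}^r x_j^{\,n-r}}\ \det\left(\frac1{2\pi\iota}\oint_{\mathrm{C}}\frac{{}_pF_q(a_{1:p}-n+1;\,b_{1:q}-n+1;\,x_i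 z)\,z^{j-1}}{\prod_{s=1}^n(z-y_s)}\,dz\right)_{i,j=1}^r,$$ where $\iota=\sqrt{-1}$, $a_{1:p}-n+1$ denotes $(a_1-n+1,\dots,a_p-n+1)$ and likewise for $b_{1:q}$, and $$K(a_{1:p},b_{1:q})=\prod_{\ell=1}^r\left[(n-\ell)!\ \prod_{i=1}^q\frac{(b_i-\ell)!}{(b_i-n)!}\ \prod_{j=1}^p\frac{(a_j-n)!}{(a_j-\ell)!}\right],\qquad \frac{(c-\ell)!}{(c-n)!}:=(c-\ell)(c-\ell-1)\cdots(c-n+1).$$ -/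

import Mathlib

open scoped unitInterval

noncomputable section

/-! ### Partitions and Jack polynomials -/

/-- The partitions of `k` with at most `n` nonzero parts, written as weakly decreasing sequences
`κ 0 ≥ κ 1 ≥ ⋯ ≥ κ (n - 1) ≥ 0` with sum `k` (padded by zeros). -/
def partitionsOf (n k : ℕ) : Finset (Fin n → ℕ) :=
  open Classical in (Finset.piAntidiag Finset.univ k).filter Antitone

/-- The dominance order: `μ₁ + ⋯ + μⱼ ≤ κ₁ + ⋯ + κⱼ` for every `j`. -/
def DominatedBy {n : ℕ} (μ κ : Fin n → ℕ) : Prop :=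
  ∀ j : Fin n, ∑ i ∈ Finset.Iic j, μ i ≤ ∑ i ∈ Finset.Iic j, κ i

/-- The Laplace-Beltrami (Calogero-Sutherland) operator
`∑ᵢ xᵢ² ∂ᵢ² + (2/α) ∑_{i ≠ j} xᵢ² / (xᵢ - xⱼ) ∂ᵢ` applied to a polynomial `f`, as a function of
points `x` with pairwise distinct coordinates. -/
def jackOperator {n : ℕ} (α : ℝ) (f : MvPolynomial (Fin n) ℝ) (x : Fin n → ℝ) : ℝ :=
  ∑ i, x i ^ 2 * (MvPolynomial.pderiv i (MvPolynomial.pderiv i f)).eval x +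
    2 / α * ∑ i, ∑ j ∈ Finset.univ.erase i,
      x i ^ 2 / (x i - x j) * (MvPolynomial.pderiv i f).eval x

/-- `C` is the family of `C`-normalized Jack polynomials of degree `k` in `n` variables with
parameter `α`: for each partition `κ` of `k` with at most `n` parts, `C κ` is a symmetric
homogeneous polynomial with highest term `κ` in the dominance order, is an eigenfunction of the
Laplace-Beltrami operator, and these polynomials add up to `(x₁ + ⋯ + xₙ) ^ k`. -/
structure IsJackFamily (α : ℝ) (n k : ℕ) (C : (Fin n → ℕ) → MvPolynomial (Fin n) ℝ) :
    Prop where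
  symmetric : ∀ κ ∈ partitionsOf n k, (C κ).IsSymmetric
  homogeneous : ∀ κ ∈ partitionsOf n k, (C κ).IsHomogeneous k
  leading : ∀ κ ∈ partitionsOf n k, (C κ).coeff (Finsupp.equivFunOnFinite.symm κ) ≠ 0
  triangular : ∀ κ ∈ partitionsOf n k, ∀ μ ∈ partitionsOf n k,
    (C κ).coeff (Finsupp.equivFunOnFinite.symm μ) ≠ 0 → DominatedBy μ κ
  eigenfunction : ∀ κ ∈ partitionsOf n k, ∃ c : ℝ, ∀ x : Fin n → ℝ, Function.Injective x →
    jackOperator α (C κ) x = c * (C κ).eval x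
  sum_eq : ∑ κ ∈ partitionsOf n k, C κ = (∑ i, MvPolynomial.X i) ^ k

/-- The `C`-normalized Jack polynomial `C_κ^{(α)}` in `n` variables. (For `α > 0` the family
described by `IsJackFamily` exists, and it is unique on the partitions of `k`.) -/
def jackC (α : ℝ) {n : ℕ} (κ : Fin n → ℕ) : MvPolynomial (Fin n) ℝ :=
  open Classical in
  if h : ∃ C, IsJackFamily α n (∑ i, κ i) C then h.choose κ else 0

/-! ### Hypergeometric functions -/

/-- The generalized Pochhammer symbol
`(a)_κ^{(α)} = ∏ᵢ Γ(a - (i-1)/α + κᵢ) / Γ(a - (i-1)/α)`, each quotient being written as the rising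
factorial `(a - (i-1)/α) (a - (i-1)/α + 1) ⋯ (a - (i-1)/α + κᵢ - 1)`. -/
def genPochhammer (α : ℝ) {n : ℕ} (a : ℂ) (κ : Fin n → ℕ) : ℂ :=
  ∏ i : Fin n, (ascPochhammer ℂ (κ i)).eval (a - ((i : ℕ) : ℂ) / (α : ℂ))

/-- The part of degree `k` of the series of the hypergeometric function of two matrix arguments
with eigenvalues `x₁, …, xₙ` and `y₁, …, yₙ`. -/
def matrixPFqTerm (α : ℝ) {p q n : ℕ} (a : Fin p → ℂ) (b : Fin q → ℂ) (x y : Fin n → ℂ)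
    (k : ℕ) : ℂ :=
  1 / (k.factorial : ℂ) * ∑ κ ∈ partitionsOf n k,
    (∏ j, genPochhammer α (a j) κ) / (∏ i, genPochhammer α (b i) κ) *
      (MvPolynomial.aeval x (jackC α κ) * MvPolynomial.aeval y (jackC α κ) /
        MvPolynomial.aeval (fun _ => (1 : ℂ)) (jackC α κ))

/-- The hypergeometric function `ₚF_q^{(α)}(a; b; X, Y)` of two matrix arguments with eigenvalues
`x₁, …, xₙ` and `y₁, …, yₙ`. -/
def matrixPFq (α : ℝ) {p q n : ℕ} (a : Fin p → ℂ) (b : Fin q → ℂ) (x y : Fin n → ℂ) : ℂ :=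
  ∑' k : ℕ, matrixPFqTerm α a b x y k

/-- The classical hypergeometric function `ₚF_q(a; b; z)` of one variable. -/
def scalarPFq {p q : ℕ} (a : Fin p → ℂ) (b : Fin q → ℂ) (z : ℂ) : ℂ :=
  ∑' k : ℕ, 1 / (k.factorial : ℂ) * ((∏ j, (ascPochhammer ℂ k).eval (a j)) /
    (∏ i, (ascPochhammer ℂ k).eval (b i))) * z ^ k

/-- `w` lies in the region of convergence of the hypergeometric series with numerator parameters
`a` and `q` denominator parameters: everything if `p ≤ q`, the open unit disc if `p = q + 1`, and
everything if the series terminates because some `aⱼ` is a non-positive integer. -/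
def InConvergenceRegion {p : ℕ} (a : Fin p → ℂ) (q : ℕ) (w : ℂ) : Prop :=
  p ≤ q ∨ (p = q + 1 ∧ ‖w‖ < 1) ∨ ∃ j, ∃ m : ℕ, a j = -(m : ℂ)

/-! ### Contours -/

/-- A path in the plane is piecewise continuously differentiable: away from finitely many
parameters it is `C¹`, with one-sided derivatives at the break points. -/
def PiecewiseC1 {z₀ z₁ : ℂ} (γ : Path z₀ z₁) : Prop :=
  ∃ P : Finset ℝ, ∀ u v : ℝ, 0 ≤ u → u < v → v ≤ 1 → Disjoint (Set.Ioo u v) (P : Set ℝ) →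
    ContDiffOn ℝ 1 γ.extend (Set.Icc u v)

/-- The contour integral `∫_γ f(z) dz`. -/
def contourIntegral {z₀ z₁ : ℂ} (γ : Path z₀ z₁) (f : ℂ → ℂ) : ℂ :=
  curveIntegral (fun z => f z • (1 : ℂ →L[ℂ] ℂ)) γ

/-- The closed path `γ` encloses `w` once counter-clockwise: it avoids `w` and its winding number
about `w` is `1`. -/
def Encloses {z₀ : ℂ} (γ : Path z₀ z₀) (w : ℂ) : Prop :=
  (∀ t : I, γ t ≠ w) ∧
    1 / (2 * (Real.pi : ℂ) * Complex.I) * contourIntegral γ (fun z => 1 / (z - w)) = 1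

/-! ### The constant -/

/-- The quotient `(z - ℓ)! / (z - n)! = (z - ℓ) (z - ℓ - 1) ⋯ (z - n + 1)` for `ℓ ≤ n`. -/
def factorialQuotient (z : ℂ) (ℓ n : ℕ) : ℂ :=
  ∏ k ∈ Finset.Ico ℓ n, (z - (k : ℂ))

/-- `K(a, b) = ∏_{ℓ = 1}^r (n-ℓ)! ∏ᵢ (bᵢ-ℓ)! / (bᵢ-n)! ∏ⱼ (aⱼ-n)! / (aⱼ-ℓ)!`. -/
def constK {p q : ℕ} (n r : ℕ) (a : Fin p → ℂ) (b : Fin q → ℂ) : ℂ :=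
  ∏ ℓ ∈ Finset.Icc 1 r, (((n - ℓ).factorial : ℂ) *
    (∏ i, factorialQuotient (b i) ℓ n) * ∏ j, (factorialQuotient (a j) ℓ n)⁻¹)

end

/-! Write l_i = κ_i + n - i for 1 ≤ i ≤ n. At α = 1 the Jack polynomial of κ is a multiple of the
Schur polynomial s_κ (`jackC_one`), and the normalized product of Jack polynomials in the series is
k! ∏ (n-i)!/l_i! · s_κ(x) s_κ(y) (`jackC_one_mul_div`). Let c_l be the coefficients of the scalar
series with all parameters lowered by n - 1. Splitting rising factorials (`prod_scalarCoeff_stair`)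
turns the κ-term of the matrix series into ∏ c_{l_i}/c_{n-i} · s_κ(x) s_κ(y).

For functionals φ_i on polynomials that kill the multiples of ∏ (X - x_s), det φ_i(X^{l_j}) is
s_κ(x) times det φ_i(X^{n-j}) (`det_functional`); coinciding points are harmless. For x, take
evaluation at the nonzero x_i and coefficient extraction for the zero ones; the factor is the
denominator of the theorem. For y, take ψ_k(f) = (2πi)⁻¹ ∮ z^{k-1} f(z)/∏ (z - y_s) dz; the factor
is 1. Cauchy-Binet (`hasSum_cauchyBinet`) then sums the series to the n × n determinant of ∑_l c_l
φ_i(X^l) ψ_k(X^l). Its first r rows are the contour integrals. Row i > r is c_{n-i} ψ_k(X^{n-i}),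
which is 0 for k < i and c_{n-i} for k = i, so only the r × r block remains, and the uncancelled
constant ∏_{i ≤ r} c_{n-i}⁻¹ is K.

The Jack polynomials are identified by conjugating the Laplace-Beltrami operator with the
Vandermonde determinant: it becomes ∑ x_i² ∂_i² up to a constant, the alternants are eigenvectors,
and the eigenvalue is strictly monotone in the dominance order. The contour integrals need only
primitives, partial fractions and the winding numbers. -/

/-! ### Determinants of functionals modulo ∏ (X - x_s) -/

open Polynomial in
/-- The determinant of the coefficients of the remainders of `X ^ l j` modulo `∏ (X - x s)`; for
`l j = κ j + n - 1 - j` it is the Schur polynomial of `κ` at `x`. -/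
noncomputable def schurEval {R : Type*} [CommRing R] {n : ℕ} (x : Fin n → R) (l : Fin n → ℕ) : R :=
  Matrix.det (Matrix.of fun i j : Fin n =>
    ((X : R[X]) ^ l j %ₘ ∏ s, (X - C (x s))).coeff (i.rev : ℕ))

-- Division by a monic polynomial commutes with ring homomorphisms. Hence Schur polynomials in
-- indeterminates specialize to any points, distinct or not.
open Polynomial in
theorem map_schurEval {R S : Type*} [CommRing R] [CommRing S] (f : R →+* S) {n : ℕ}
    (x : Fin n → R) (l : Fin n → ℕ) : f (schurEval x l) = schurEval (fun i => f (x i)) l := by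
  unfold schurEval
  rw [RingHom.map_det]
  congr 1
  ext i j
  have hm : (∏ s, (X - C (x s))).Monic := monic_prod_of_monic _ _ fun s _ => monic_X_sub_C _
  have := congrArg (fun g => g.coeff (i.rev : ℕ)) (map_modByMonic f hm (p := X ^ l j))
  simpa [Polynomial.map_prod] using this

open Polynomial in
/-- If linear functionals vanish on the multiples of `∏ (X - x s)`, then their determinants on
monomials factor through `schurEval`. -/
theorem det_functional {R : Type*} [CommRing R] {n : ℕ} (x : Fin n → R)
    (φ : Fin n → R[X] →ₗ[R] R) (hφ : ∀ i f, φ i ((∏ s, (X - C (x s))) * f) = 0)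
    (l : Fin n → ℕ) :
    Matrix.det (Matrix.of fun i j : Fin n => φ i (X ^ l j)) =
      Matrix.det (Matrix.of fun i j : Fin n => φ i (X ^ (j.rev : ℕ))) * schurEval x l := by
  nontriviality R
  unfold schurEval
  set P : R[X] := ∏ s, (X - C (x s))
  have hm : P.Monic := monic_prod_of_monic _ _ fun s _ => monic_X_sub_C _
  have hdeg : P.natDegree = n := by
    simp [P, natDegree_prod_of_monic _ _ fun s _ => monic_X_sub_C (x s)]
  rw [← Matrix.det_mul]
  congr 1
  ext i j
  rw [Matrix.mul_apply]
  simp only [Matrix.of_apply]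
  have h1 : φ i (X ^ l j) = φ i (X ^ l j %ₘ P) := by
    conv_lhs => rw [← modByMonic_add_div (X ^ l j) P]
    rw [map_add, hφ, add_zero]
  have h2 : (X ^ l j %ₘ P : R[X]).degree < (n : ℕ) := by
    have := degree_modByMonic_lt (X ^ l j) hm
    rwa [degree_eq_natDegree hm.ne_zero, hdeg] at this
  have h3 : (X ^ l j %ₘ P : R[X]) =
      ∑ t : Fin n, (X ^ l j %ₘ P : R[X]).coeff (t : ℕ) • X ^ (t : ℕ) := by
    rw [Fin.sum_univ_eq_sum_range (fun t => (X ^ l j %ₘ P : R[X]).coeff t • (X : R[X]) ^ t)]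
    ext m
    simp only [finsetSum_coeff, coeff_smul, coeff_X_pow, smul_eq_mul, mul_ite, mul_one, mul_zero]
    rw [Finset.sum_ite_eq]
    split_ifs with hmem
    · rfl
    · exact coeff_eq_zero_of_degree_lt (h2.trans_le (by simpa using hmem))
  rw [h1, h3, map_sum, ← Equiv.sum_comp Fin.revPerm]
  refine Finset.sum_congr rfl fun t _ => ?_
  rw [map_smul, smul_eq_mul, mul_comm, ← h3]
  rfl

open Polynomial in
/-- The bialternant formula. -/
theorem det_pow_eq {R : Type*} [CommRing R] {n : ℕ} (x : Fin n → R) (l : Fin n → ℕ) :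
    Matrix.det (Matrix.of fun i j : Fin n => x i ^ l j) =
      Matrix.det (Matrix.of fun i j : Fin n => x i ^ (j.rev : ℕ)) * schurEval x l := by
  have := det_functional x (fun i => leval (x i)) (fun i f => by
    simp only [leval_apply, eval_mul, eval_prod]
    rw [Finset.prod_eq_zero (Finset.mem_univ i) (by simp), zero_mul]) l
  simpa [leval_apply] using this

-- The functionals f ↦ f^{(n-1-i)}(1) kill the multiples of (X - 1)^n, because fewer than n
-- derivatives leave a factor X - 1. This reaches the value at (1, …, 1), where the bialternant
-- formula reads 0 = 0.
open Polynomial in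
theorem det_descFactorial_eq {n : ℕ} (l : Fin n → ℕ) :
    Matrix.det (Matrix.of fun i j : Fin n => ((l j).descFactorial (i.rev : ℕ) : ℝ)) =
      Matrix.det (Matrix.of fun i j : Fin n =>
        (((j.rev : ℕ).descFactorial (i.rev : ℕ) : ℕ) : ℝ)) * schurEval (fun _ => (1 : ℝ)) l := by
  have := det_functional (fun _ : Fin n => (1 : ℝ))
    (fun i => leval 1 ∘ₗ (derivative ^ (i.rev : ℕ) : ℝ[X] →ₗ[ℝ] ℝ[X])) (fun i f => by
      have h : (X - C (1 : ℝ)) ^ (n - (i.rev : ℕ)) ∣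
          derivative^[(i.rev : ℕ)] ((X - C (1 : ℝ)) ^ n * f) := by
        exact pow_sub_dvd_iterate_derivative_of_pow_dvd _ (Dvd.intro _ rfl)
      obtain ⟨g, hg⟩ := h
      have h0 : n - (i.rev : ℕ) ≠ 0 := by have := i.rev.2; omega
      simp only [Finset.prod_const, Finset.card_univ, Fintype.card_fin, LinearMap.comp_apply,
        Module.End.pow_apply, hg, leval_apply, eval_mul, eval_pow, eval_sub, eval_X, eval_C,
        sub_self, zero_pow h0, zero_mul]) l
  simpa [leval_apply, Module.End.pow_apply, iterate_derivative_X_pow_eq_smul] using this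

/-- The determinant of falling factorials is a Vandermonde determinant. -/
theorem det_descFactorial_ne_zero {n : ℕ} {l : Fin n → ℕ} (hl : Function.Injective l) :
    Matrix.det (Matrix.of fun i j : Fin n => ((l j).descFactorial (i.rev : ℕ) : ℝ)) ≠ 0 := by
  have h := Matrix.det_eval_matrixOfPolynomials_eq_det_vandermonde (fun i => (l i : ℝ))
    (fun i => descPochhammer ℝ i) (fun i => descPochhammer_natDegree ℝ i)
    (fun i => monic_descPochhammer ℝ i)
  have h1 : Matrix.det (Matrix.of fun i j : Fin n => ((l j).descFactorial (i : ℕ) : ℝ)) ≠ 0 := by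
    rw [← Matrix.det_transpose]
    have : (Matrix.of fun i j : Fin n => ((l j).descFactorial (i : ℕ) : ℝ)).transpose =
        Matrix.of fun i j : Fin n => (descPochhammer ℝ j).eval (l i : ℝ) := by
      ext i j
      simp [descPochhammer_eval_eq_descFactorial]
    rw [this]
    erw [← h]
    rw [Matrix.det_vandermonde_ne_zero_iff]
    exact Nat.cast_injective.comp hl
  have h2 := Matrix.det_permute Fin.revPerm
    (Matrix.of fun i j : Fin n => ((l j).descFactorial (i : ℕ) : ℝ))
  have h3 : (Matrix.of fun i j : Fin n => ((l j).descFactorial (i.rev : ℕ) : ℝ)) =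
      (Matrix.of fun i j : Fin n => ((l j).descFactorial (i : ℕ) : ℝ)).submatrix
        Fin.revPerm id := by
    ext i j
    simp
  rw [h3, h2]
  refine mul_ne_zero ?_ h1
  rcases Int.units_eq_one_or (Equiv.Perm.sign (Fin.revPerm : Equiv.Perm (Fin n))) with h | h <;>
    simp [h]

theorem det_descFactorial_rev {n : ℕ} :
    Matrix.det (Matrix.of fun i j : Fin n =>
        (((j.rev : ℕ).descFactorial (i.rev : ℕ) : ℕ) : ℝ)) = ∏ i : Fin n, ((i.rev : ℕ).factorial : ℝ) := by
  rw [Matrix.det_of_isLowerTriangular]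
  · simp [Nat.descFactorial_self]
  · intro i j hij
    simp only [Matrix.of_apply, Nat.cast_eq_zero, Nat.descFactorial_eq_zero_iff_lt]
    have : i < j := hij
    exact Fin.rev_lt_rev.2 this

/-! ### Partitions, strictly decreasing sequences and the dominance order -/

/-- The strictly decreasing sequence `κ i + (n - 1 - i)` attached to a partition. -/
def stair {n : ℕ} (κ : Fin n → ℕ) : Fin n → ℕ := fun i => κ i + (i.rev : ℕ)

theorem mem_partitionsOf {n k : ℕ} {κ : Fin n → ℕ} :
    κ ∈ partitionsOf n k ↔ ∑ i, κ i = k ∧ Antitone κ := by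
  simp [partitionsOf]

theorem stair_strictAnti {n : ℕ} {κ : Fin n → ℕ} (hκ : Antitone κ) : StrictAnti (stair κ) := by
  intro i j hij
  have h1 := hκ hij.le
  have h2 : ((Fin.rev j : Fin n) : ℕ) < (Fin.rev i : Fin n) := Fin.rev_lt_rev.2 hij
  simp only [stair]
  omega

theorem stair_injective {n : ℕ} : Function.Injective (stair : (Fin n → ℕ) → Fin n → ℕ) := by
  intro κ μ h
  funext i
  have := congrFun h i
  simpa [stair] using this

theorem StrictAnti.add_sub_le {n : ℕ} {l : Fin n → ℕ} (hl : StrictAnti l) :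
    ∀ (d : ℕ) (i j : Fin n), (j : ℕ) = i + d → l j + d ≤ l i := by
  intro d
  induction d with
  | zero => intro i j h; rw [show j = i from Fin.ext (by simpa using h)]; simp
  | succ d ih =>
    intro i j h
    have h1 := ih i ⟨i + d, by omega⟩ rfl
    have h2 := hl (a := ⟨i + d, by omega⟩) (b := j) (by rw [Fin.lt_def]; simp only; omega)
    omega

theorem exists_stair_eq {n : ℕ} {l : Fin n → ℕ} (hl : StrictAnti l) :
    ∃ κ, Antitone κ ∧ stair κ = l := by
  -- Comparison with the last index n - 1: there are n - 1 - i strict descents after i.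
  have key : ∀ i : Fin n, (i.rev : ℕ) ≤ l i := fun i => by
    have := hl.add_sub_le (i.rev : ℕ) i ⟨n - 1, by have := i.2; omega⟩
      (by simp [Fin.val_rev]; omega)
    omega
  refine ⟨fun i => l i - (i.rev : ℕ), fun i j hij => ?_, ?_⟩
  · have h1 := hl.add_sub_le (j - i : ℕ) i j (by have : (i : ℕ) ≤ j := hij; omega)
    have := key i
    have := key j
    have : (i : ℕ) ≤ j := hij
    simp only [Fin.val_rev] at *
    omega
  · funext i
    exact Nat.sub_add_cancel (key i)

theorem exists_perm_antitone {n : ℕ} (m : Fin n → ℕ) :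
    ∃ w : Equiv.Perm (Fin n), Antitone (m ∘ w) := by
  refine ⟨Fin.revPerm.trans (Tuple.sort m), ?_⟩
  have h := Tuple.monotone_sort m
  intro i j hij
  exact h (Fin.rev_le_rev.2 hij)

theorem exists_perm_strictAnti {n : ℕ} {m : Fin n → ℕ} (hm : Function.Injective m) :
    ∃ w : Equiv.Perm (Fin n), StrictAnti (m ∘ w) := by
  obtain ⟨w, hw⟩ := exists_perm_antitone m
  exact ⟨w, hw.strictAnti_of_injective (hm.comp w.injective)⟩

theorem DominatedBy.trans {n : ℕ} {κ μ ν : Fin n → ℕ} (h₁ : DominatedBy κ μ)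
    (h₂ : DominatedBy μ ν) : DominatedBy κ ν := fun j => (h₁ j).trans (h₂ j)

theorem eq_of_sum_Iic_eq {n : ℕ} {κ μ : Fin n → ℕ}
    (h : ∀ j, ∑ i ∈ Finset.Iic j, κ i = ∑ i ∈ Finset.Iic j, μ i) : κ = μ := by
  have key : ∀ m : ℕ, ∀ j : Fin n, (j : ℕ) = m → κ j = μ j := by
    intro m
    induction m using Nat.strong_induction_on with
    | _ m ih =>
      intro j hj
      have h1 := h j
      rw [← Finset.Iio_insert, Finset.sum_insert (by simp), Finset.sum_insert (by simp)] at h1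
      have h2 : ∑ i ∈ Finset.Iio j, κ i = ∑ i ∈ Finset.Iio j, μ i :=
        Finset.sum_congr rfl fun i hi => ih i (by
          have : i < j := Finset.mem_Iio.1 hi
          exact hj ▸ this) i rfl
      omega
  exact funext fun j => key j j rfl

theorem DominatedBy.antisymm {n : ℕ} {κ μ : Fin n → ℕ} (h₁ : DominatedBy κ μ)
    (h₂ : DominatedBy μ κ) : κ = μ := eq_of_sum_Iic_eq fun j => (h₁ j).antisymm (h₂ j)

/-- The rearrangement inequality, applied to κ and the indicator of the indices ≤ j. -/
theorem dominatedBy_comp_perm {n : ℕ} {κ : Fin n → ℕ} (hκ : Antitone κ)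
    (w : Equiv.Perm (Fin n)) : DominatedBy (κ ∘ w) κ := by
  intro j
  have hmono : Monovary (fun i => if i ≤ j then 1 else 0) κ := by
    intro a b hab
    have : b ≤ a := by
      by_contra! h
      exact absurd (hκ h.le) (not_le.2 hab)
    dsimp only
    split_ifs with h1 h2
    · rfl
    · exact absurd (this.trans h1) h2
    · simp
    · rfl
  have : ∑ i, (if i ≤ j then 1 else 0) * κ (w i) ≤ ∑ i, (if i ≤ j then 1 else 0) * κ i :=
    hmono.sum_mul_comp_perm_le_sum_mul
  simpa [Finset.sum_ite, ← Finset.filter_ge_eq_Iic] using this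

/-- Abel summation: subtracting the last weight from all the others reduces to n - 1 indices. -/
theorem sum_mul_nonneg_of_sum_Iic_nonneg : ∀ {n : ℕ} (d w : Fin n → ℤ), Antitone w →
    (∀ i, 0 ≤ w i) → (∀ j, 0 ≤ ∑ i ∈ Finset.Iic j, d i) → 0 ≤ ∑ i, d i * w i := by
  intro n
  induction n with
  | zero => intro d w _ _ _; simp
  | succ n ih =>
    intro d w hw h0 hd
    have h1 := ih (fun i => d i.castSucc) (fun i => w i.castSucc - w (Fin.last n))
      (fun i j hij => by simpa using hw (Fin.castSucc_le_castSucc_iff.2 hij))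
      (fun i => by simpa using hw (Fin.le_last _))
      (fun j => by
        have := hd j.castSucc
        rwa [Fin.sum_Iic_castSucc] at this)
    have h2 := hd (Fin.last n)
    have h3 : Finset.Iic (Fin.last n) = Finset.univ := by ext; simp [Fin.le_last]
    rw [h3] at h2
    have h4 := mul_nonneg h2 (h0 (Fin.last n))
    rw [Fin.sum_univ_castSucc] at h2 h4 ⊢
    simp only [mul_sub, Finset.sum_sub_distrib, ← Finset.sum_mul] at h1
    linarith

theorem sum_sum_Iic {n : ℕ} (d : Fin n → ℤ) :
    ∑ j, ∑ i ∈ Finset.Iic j, d i = ∑ i, d i * ((i.rev : ℕ) : ℤ) + ∑ i, d i := by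
  have : ∑ j, ∑ i ∈ Finset.Iic j, d i = ∑ i, ∑ j ∈ Finset.Ici i, d i := by
    apply Finset.sum_comm'
    simp
  rw [this, ← Finset.sum_add_distrib]
  refine Finset.sum_congr rfl fun i _ => ?_
  rw [Finset.sum_const, Fin.card_Ici, nsmul_eq_mul, Fin.val_rev]
  have : n - (i : ℕ) = (n - (i + 1)) + 1 := by have := i.2; omega
  rw [this]
  push_cast
  ring

/-- The quantity `∑ (κ i + n - 1 - i) ^ 2` is strictly monotone for the dominance order. -/
theorem eq_of_dominatedBy_of_sum_sq_le {n : ℕ} {κ μ : Fin n → ℕ} (hκ : Antitone κ)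
    (hμ : Antitone μ) (hsum : ∑ i, μ i = ∑ i, κ i) (h : DominatedBy μ κ)
    (hsq : ∑ i, stair κ i ^ 2 ≤ ∑ i, stair μ i ^ 2) : μ = κ := by
  set d : Fin n → ℤ := fun i => (κ i : ℤ) - μ i with hd
  have hd0 : ∀ j, 0 ≤ ∑ i ∈ Finset.Iic j, d i := fun j => by
    rw [hd, Finset.sum_sub_distrib, sub_nonneg]
    exact_mod_cast h j
  have hdt : ∑ i, d i = 0 := by
    rw [hd, Finset.sum_sub_distrib, sub_eq_zero]
    exact_mod_cast hsum.symm
  have h1 := sum_mul_nonneg_of_sum_Iic_nonneg d (fun i => (κ i : ℤ) + μ i)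
    (fun i j hij => by
      have h1 := hκ hij
      have h2 := hμ hij
      dsimp only
      exact_mod_cast add_le_add h1 h2)
    (fun i => by positivity) hd0
  have h2 := sum_sum_Iic d
  -- A difference of squares. By `sum_sum_Iic` the last sum is the total of the partial sums of d,
  -- so both parts are nonnegative; `hsq` then forces every partial sum to vanish.
  have h3 : (∑ i, (stair κ i : ℤ) ^ 2) - ∑ i, (stair μ i : ℤ) ^ 2 =
      ∑ i, d i * ((κ i : ℤ) + μ i) + 2 * ∑ i, d i * ((i.rev : ℕ) : ℤ) := by
    rw [← Finset.sum_sub_distrib, Finset.mul_sum, ← Finset.sum_add_distrib]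
    refine Finset.sum_congr rfl fun i _ => ?_
    simp only [stair, hd]
    push_cast
    ring
  have h4 : ∑ i, (stair κ i : ℤ) ^ 2 ≤ ∑ i, (stair μ i : ℤ) ^ 2 := by exact_mod_cast hsq
  have h5 : ∑ j, ∑ i ∈ Finset.Iic j, d i = 0 :=
    le_antisymm (by linarith) (Finset.sum_nonneg fun j _ => hd0 j)
  have h6 := (Finset.sum_eq_zero_iff_of_nonneg fun j _ => hd0 j).1 h5
  refine eq_of_sum_Iic_eq fun j => ?_
  have := h6 j (Finset.mem_univ j)
  rw [hd, Finset.sum_sub_distrib, sub_eq_zero] at this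
  exact_mod_cast this.symm

/-- A sequence of exponents as a finitely supported function. -/
noncomputable abbrev toExp {n : ℕ} (m : Fin n → ℕ) : Fin n →₀ ℕ := Finsupp.equivFunOnFinite.symm m

theorem toExp_coe {n : ℕ} (m : Fin n →₀ ℕ) : toExp (m : Fin n → ℕ) = m :=
  Finsupp.equivFunOnFinite_symm_coe m

theorem toExp_injective {n : ℕ} : Function.Injective (toExp : (Fin n → ℕ) → _) :=
  Finsupp.equivFunOnFinite.symm.injective

theorem toExp_sub {n : ℕ} (m l : Fin n → ℕ) : toExp m - toExp l = toExp (m - l) := by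
  ext i
  simp

theorem toExp_le {n : ℕ} {m l : Fin n → ℕ} : toExp m ≤ toExp l ↔ m ≤ l := Iff.rfl

theorem degree_toExp {n : ℕ} (m : Fin n → ℕ) : (toExp m).degree = ∑ i, m i := by
  rw [Finsupp.degree_eq_sum]
  rfl

/-! ### Alternants and Schur polynomials -/

section Alternants

open MvPolynomial

/-- The alternant `det (X_i ^ l_j)`. -/
noncomputable def alternant {n : ℕ} (l : Fin n → ℕ) : MvPolynomial (Fin n) ℝ :=
  Matrix.det (Matrix.of fun i j : Fin n => (X i : MvPolynomial (Fin n) ℝ) ^ l j)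

/-- The Vandermonde determinant in the variables. -/
noncomputable def vanderPoly (n : ℕ) : MvPolynomial (Fin n) ℝ :=
  alternant fun j : Fin n => (j.rev : ℕ)

/-- The Schur polynomial of a partition. -/
noncomputable def schurPoly {n : ℕ} (κ : Fin n → ℕ) : MvPolynomial (Fin n) ℝ :=
  schurEval X (stair κ)

theorem vanderPoly_mul_schurPoly {n : ℕ} (κ : Fin n → ℕ) :
    vanderPoly n * schurPoly κ = alternant (stair κ) := (det_pow_eq X (stair κ)).symm

theorem alternant_eq_sum {n : ℕ} (l : Fin n → ℕ) :
    alternant l = ∑ w : Equiv.Perm (Fin n),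
      monomial (toExp (l ∘ w)) (((Equiv.Perm.sign w : ℤ) : ℝ)) := by
  rw [alternant, Matrix.det_apply', ← Equiv.sum_comp (Equiv.inv _)]
  refine Finset.sum_congr rfl fun w _ => ?_
  rw [monomial_eq, Finsupp.prod_fintype _ _ (by simp), ← Equiv.prod_comp w]
  simp

open Classical in
theorem coeff_alternant_mul {n : ℕ} (l m : Fin n → ℕ) (f : MvPolynomial (Fin n) ℝ) :
    coeff (toExp m) (alternant l * f) = ∑ w : Equiv.Perm (Fin n),
      if l ∘ w ≤ m then ((Equiv.Perm.sign w : ℤ) : ℝ) * coeff (toExp (m - l ∘ w)) f else 0 := by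
  rw [alternant_eq_sum, Finset.sum_mul, coeff_sum]
  refine Finset.sum_congr rfl fun w _ => ?_
  rw [coeff_monomial_mul', toExp_sub]
  exact if_congr toExp_le rfl rfl

theorem strictAnti_comp_perm {n : ℕ} {l m : Fin n → ℕ} (hl : StrictAnti l) (hm : StrictAnti m)
    {w : Equiv.Perm (Fin n)} (h : l ∘ w = m) : w = 1 := by
  have hw : StrictMono w := fun i j hij => by
    have := hm hij
    rw [← h] at this
    exact hl.lt_iff_gt.1 this
  exact DFunLike.coe_injective
    ((hw.range_inj strictMono_id).1 (by rw [w.surjective.range_eq, Set.range_id]))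

theorem coeff_alternant {n : ℕ} {l m : Fin n → ℕ} (hl : StrictAnti l) (hm : StrictAnti m) :
    coeff (toExp m) (alternant l) = if l = m then 1 else 0 := by
  rw [alternant_eq_sum, coeff_sum]
  simp only [coeff_monomial]
  split_ifs with h
  · subst h
    rw [Finset.sum_eq_single 1]
    · simp
    · intro w _ hw
      rw [if_neg fun h => hw (strictAnti_comp_perm hl hm (toExp_injective h))]
    · simp
  · refine Finset.sum_eq_zero fun w _ => if_neg fun hw => h ?_
    have h1 := toExp_injective hw
    rw [strictAnti_comp_perm hl hm h1] at h1
    simpa using h1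

theorem rev_strictAnti {n : ℕ} : StrictAnti fun j : Fin n => (j.rev : ℕ) :=
  fun _ _ h => Fin.rev_lt_rev.2 h

theorem vanderPoly_ne_zero (n : ℕ) : vanderPoly n ≠ 0 := by
  intro h
  have := coeff_alternant (n := n) rev_strictAnti rev_strictAnti
  rw [← vanderPoly, h] at this
  simp at this

theorem alternant_isHomogeneous {n : ℕ} (l : Fin n → ℕ) :
    (alternant l).IsHomogeneous (∑ i, l i) := by
  rw [alternant_eq_sum]
  refine IsHomogeneous.sum _ _ _ fun w _ => isHomogeneous_monomial _ ?_
  rw [degree_toExp]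
  exact Equiv.sum_comp w l

theorem rename_alternant {n : ℕ} (l : Fin n → ℕ) (w : Equiv.Perm (Fin n)) :
    rename w (alternant l) = ((Equiv.Perm.sign w : ℤ) : MvPolynomial (Fin n) ℝ) * alternant l := by
  rw [alternant, ← Matrix.det_permute, ← AlgHom.coe_toRingHom, RingHom.map_det]
  congr 1
  ext i j
  simp

theorem coeff_comp_perm_rename {n : ℕ} (f : MvPolynomial (Fin n) ℝ) (w : Equiv.Perm (Fin n))
    (m : Fin n → ℕ) : coeff (toExp m) (rename w f) = coeff (toExp (m ∘ w)) f := by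
  rw [← coeff_rename_mapDomain w w.injective f]
  congr 1
  ext i
  rw [Finsupp.mapDomain_equiv_apply]
  simp

theorem MvPolynomial.IsSymmetric.coeff_comp_perm {n : ℕ} {f : MvPolynomial (Fin n) ℝ}
    (hf : f.IsSymmetric) (w : Equiv.Perm (Fin n)) (m : Fin n → ℕ) :
    coeff (toExp (m ∘ w)) f = coeff (toExp m) f := by
  rw [← coeff_comp_perm_rename, hf w]

/-- An alternating polynomial is determined by its coefficients at strictly decreasing exponents. -/
theorem eq_of_alternating {n : ℕ} {g h : MvPolynomial (Fin n) ℝ}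
    (hg : ∀ w : Equiv.Perm (Fin n),
      rename w g = ((Equiv.Perm.sign w : ℤ) : MvPolynomial (Fin n) ℝ) * g)
    (hh : ∀ w : Equiv.Perm (Fin n),
      rename w h = ((Equiv.Perm.sign w : ℤ) : MvPolynomial (Fin n) ℝ) * h)
    (H : ∀ m : Fin n → ℕ, StrictAnti m → coeff (toExp m) g = coeff (toExp m) h) : g = h := by
  have key : ∀ {g : MvPolynomial (Fin n) ℝ}, (∀ w : Equiv.Perm (Fin n),
      rename w g = ((Equiv.Perm.sign w : ℤ) : MvPolynomial (Fin n) ℝ) * g) →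
      ∀ (w : Equiv.Perm (Fin n)) m, coeff (toExp (m ∘ w)) g =
        ((Equiv.Perm.sign w : ℤ) : ℝ) * coeff (toExp m) g := by
    intro g hg w m
    rw [← coeff_comp_perm_rename, hg w, ← coeff_C_mul]
    simp
  ext m
  rw [← toExp_coe m]
  by_cases hm : Function.Injective m
  · obtain ⟨w, hw⟩ := exists_perm_strictAnti hm
    have h1 := H _ hw
    rw [key hg, key hh] at h1
    refine mul_left_cancel₀ ?_ h1
    rcases Int.units_eq_one_or (Equiv.Perm.sign w) with h | h <;> simp [h]
  · have h0 : ∀ {g : MvPolynomial (Fin n) ℝ}, (∀ w : Equiv.Perm (Fin n),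
        rename w g = ((Equiv.Perm.sign w : ℤ) : MvPolynomial (Fin n) ℝ) * g) →
        coeff (toExp m) g = 0 := by
      intro g hg
      simp only [Function.Injective, not_forall] at hm
      obtain ⟨i, j, hij, hne⟩ := hm
      have h1 := key hg (Equiv.swap i j) m
      have h2 : (m : Fin n → ℕ) ∘ Equiv.swap i j = m := by
        funext t
        rcases eq_or_ne t i with rfl | h1
        · simp [hij]
        rcases eq_or_ne t j with rfl | h2
        · simp [hij]
        simp [Equiv.swap_apply_of_ne_of_ne h1 h2]
      rw [h2, Equiv.Perm.sign_swap hne] at h1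
      simp only [Units.val_neg, Units.val_one, Int.cast_neg, Int.cast_one, neg_mul, one_mul] at h1
      linarith
    rw [h0 hg, h0 hh]

theorem rename_vanderPoly_mul {n : ℕ} {f : MvPolynomial (Fin n) ℝ} (hf : f.IsSymmetric)
    (w : Equiv.Perm (Fin n)) : rename w (vanderPoly n * f) =
      ((Equiv.Perm.sign w : ℤ) : MvPolynomial (Fin n) ℝ) * (vanderPoly n * f) := by
  rw [map_mul, vanderPoly, rename_alternant, hf w, mul_assoc]

theorem schurPoly_isSymmetric {n : ℕ} (κ : Fin n → ℕ) : (schurPoly κ).IsSymmetric := by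
  intro w
  have h := congrArg (rename w) (vanderPoly_mul_schurPoly κ)
  rw [map_mul, vanderPoly, rename_alternant, rename_alternant, ← vanderPoly,
    ← vanderPoly_mul_schurPoly, mul_assoc] at h
  have hu : ((Equiv.Perm.sign w : ℤ) : MvPolynomial (Fin n) ℝ) ≠ 0 := by
    rcases Int.units_eq_one_or (Equiv.Perm.sign w) with h | h <;> simp [h]
  exact mul_left_cancel₀ (vanderPoly_ne_zero n) (mul_left_cancel₀ hu h)

theorem sum_stair {n : ℕ} (κ : Fin n → ℕ) : ∑ i, stair κ i = ∑ i, κ i + ∑ i : Fin n, (i.rev : ℕ) :=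
  Finset.sum_add_distrib

/-- The product with the homogeneous Vandermonde polynomial is homogeneous, so only the component of
degree |κ| contributes to it; cancelling the Vandermonde leaves that component. -/
theorem schurPoly_isHomogeneous {n : ℕ} (κ : Fin n → ℕ) :
    (schurPoly κ).IsHomogeneous (∑ i, κ i) := by
  have h : vanderPoly n * homogeneousComponent (∑ i, κ i) (schurPoly κ) =
      vanderPoly n * schurPoly κ := by
    ext m
    rw [← toExp_coe m]
    by_cases hm : ∑ i, m i = ∑ i, stair κ i
    · rw [vanderPoly, coeff_alternant_mul, coeff_alternant_mul]
      refine Finset.sum_congr rfl fun w _ => ?_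
      split_ifs with hw
      · rw [coeff_homogeneousComponent, degree_toExp, if_pos]
        have h1 : ∑ i, ((m : Fin n → ℕ) - (fun j : Fin n => (j.rev : ℕ)) ∘ w) i +
            ∑ i, ((fun j : Fin n => (j.rev : ℕ)) ∘ w) i = ∑ i, m i := by
          rw [← Finset.sum_add_distrib]
          exact Finset.sum_congr rfl fun i _ => Nat.sub_add_cancel (hw i)
        have h2 : ∑ i, ((fun j : Fin n => (j.rev : ℕ)) ∘ w) i = ∑ i : Fin n, (i.rev : ℕ) :=
          Equiv.sum_comp w fun j : Fin n => (j.rev : ℕ)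
        rw [hm, sum_stair, h2] at h1
        omega
      · rfl
    · rw [vanderPoly_mul_schurPoly, (alternant_isHomogeneous _).coeff_eq_zero
        (by rwa [degree_toExp]), vanderPoly, ((alternant_isHomogeneous _).mul
        (homogeneousComponent_isHomogeneous _ _)).coeff_eq_zero]
      rwa [degree_toExp, add_comm, ← sum_stair]
  rw [← mul_left_cancel₀ (vanderPoly_ne_zero n) h]
  exact homogeneousComponent_isHomogeneous _ _

/-- Expansion of symmetric polynomials in Schur polynomials. -/
theorem eq_sum_schurPoly {n k : ℕ} {f : MvPolynomial (Fin n) ℝ} (hf : f.IsSymmetric)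
    (hk : f.IsHomogeneous k) : f = ∑ κ ∈ partitionsOf n k,
      C (coeff (toExp (stair κ)) (vanderPoly n * f)) * schurPoly κ := by
  refine mul_left_cancel₀ (vanderPoly_ne_zero n) ?_
  have hs : (∑ κ ∈ partitionsOf n k,
      C (coeff (toExp (stair κ)) (vanderPoly n * f)) * schurPoly κ).IsSymmetric := by
    intro w
    rw [map_sum]
    refine Finset.sum_congr rfl fun κ _ => ?_
    rw [map_mul, rename_C, schurPoly_isSymmetric κ w]
  refine eq_of_alternating (rename_vanderPoly_mul hf) (rename_vanderPoly_mul hs) fun m hm => ?_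
  rw [Finset.mul_sum, coeff_sum]
  have h1 : ∀ κ ∈ partitionsOf n k, coeff (toExp m) (vanderPoly n *
      (C (coeff (toExp (stair κ)) (vanderPoly n * f)) * schurPoly κ)) =
      if stair κ = m then coeff (toExp m) (vanderPoly n * f) else 0 := by
    intro κ hκ
    rw [mul_left_comm, coeff_C_mul, vanderPoly_mul_schurPoly,
      coeff_alternant (stair_strictAnti (mem_partitionsOf.1 hκ).2) hm]
    split_ifs with h
    · rw [h, mul_one]
    · rw [mul_zero]
  rw [Finset.sum_congr rfl h1]
  obtain ⟨μ, hμ, rfl⟩ := exists_stair_eq hm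
  simp only [stair_injective.eq_iff, Finset.sum_ite_eq']
  split_ifs with h
  · rfl
  · refine ((alternant_isHomogeneous _).mul hk).coeff_eq_zero ?_
    rw [degree_toExp, sum_stair, add_comm]
    intro h2
    exact h (mem_partitionsOf.2 ⟨by omega, hμ⟩)

end Alternants

/-! ### The Laplace-Beltrami operator at α = 1 -/

section Operator

open MvPolynomial

/-- The operator `∑ᵢ xᵢ² ∂ᵢ²`. -/
noncomputable def eulerSq {n : ℕ} (f : MvPolynomial (Fin n) ℝ) : MvPolynomial (Fin n) ℝ :=
  ∑ i, X i ^ 2 * pderiv i (pderiv i f)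

theorem coeff_eulerSq {n : ℕ} (f : MvPolynomial (Fin n) ℝ) (m : Fin n → ℕ) :
    coeff (toExp m) (eulerSq f) = (∑ i, (m i : ℝ) * (m i - 1)) * coeff (toExp m) f := by
  rw [eulerSq, coeff_sum, Finset.sum_mul]
  refine Finset.sum_congr rfl fun i _ => ?_
  rw [X_pow_eq_monomial, coeff_monomial_mul']
  split_ifs with h
  · have h2 : 2 ≤ m i := by simpa using h i
    rw [coeff_pderiv, coeff_pderiv]
    have h3 : toExp m - Finsupp.single i 2 + Finsupp.single i 1 + Finsupp.single i 1 =
        toExp m := by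
      rw [add_assoc, ← Finsupp.single_add, tsub_add_cancel_of_le h]
    rw [h3]
    simp only [Finsupp.coe_add, Finsupp.coe_tsub, Pi.add_apply, Pi.sub_apply,
      Finsupp.single_eq_same, Finsupp.coe_equivFunOnFinite_symm]
    have h4 : ((m i - 2 : ℕ) : ℝ) = m i - 2 := by push_cast [h2]; ring
    push_cast
    rw [h4]
    ring
  · have h2 : m i < 2 := by
      by_contra! h2
      exact h fun j => by
        rcases eq_or_ne j i with rfl | hj
        · simpa using h2
        · simp [hj.symm]
    interval_cases hm : m i <;> simp

theorem eulerSq_C_mul {n : ℕ} (a : ℝ) (f : MvPolynomial (Fin n) ℝ) :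
    eulerSq (C a * f) = C a * eulerSq f := by
  simp only [eulerSq, pderiv_C_mul, Finset.mul_sum, mul_left_comm]

/-- Monomials are eigenvectors, with an eigenvalue that is symmetric in the exponents; all monomials
of an alternant share it. -/
theorem eulerSq_alternant {n : ℕ} (l : Fin n → ℕ) :
    eulerSq (alternant l) = C (∑ i, (l i : ℝ) * (l i - 1)) * alternant l := by
  ext m
  rw [← toExp_coe m, coeff_eulerSq, coeff_C_mul]
  by_cases h : ∃ w : Equiv.Perm (Fin n), l ∘ w = m
  · obtain ⟨w, hw⟩ := h
    rw [← hw]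
    congr 1
    exact Equiv.sum_comp w fun i => (l i : ℝ) * (l i - 1)
  · have : coeff (toExp m) (alternant l) = 0 := by
      rw [alternant_eq_sum, coeff_sum]
      refine Finset.sum_eq_zero fun w _ => ?_
      rw [coeff_monomial, if_neg fun hw => h ⟨w, toExp_injective hw⟩]
    rw [this, mul_zero, mul_zero]

theorem eval_pderiv_prod {n : ℕ} {ι : Type*} (s : Finset ι) (F : ι → MvPolynomial (Fin n) ℝ)
    (x : Fin n → ℝ) (i : Fin n) (hF : ∀ p ∈ s, eval x (F p) ≠ 0) :
    eval x (pderiv i (∏ p ∈ s, F p)) =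
      eval x (∏ p ∈ s, F p) * ∑ p ∈ s, eval x (pderiv i (F p)) / eval x (F p) := by
  classical
  induction s using Finset.induction_on with
  | empty => simp
  | insert p s hp ih =>
    have h0 := hF p (Finset.mem_insert_self _ _)
    rw [Finset.prod_insert hp, Finset.sum_insert hp, Derivation.leibniz, map_add, smul_eq_mul,
      smul_eq_mul, map_mul, map_mul, ih fun q hq => hF q (Finset.mem_insert_of_mem hq), map_mul]
    field_simp
    ring

/-- The two determinants differ by reversing columns. The sign is left unspecified since it cancels
in logarithmic derivatives. -/
theorem vanderPoly_eq_prod (n : ℕ) : ∃ u : ℤˣ, vanderPoly n =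
    ((u : ℤ) : MvPolynomial (Fin n) ℝ) * ∏ i : Fin n, ∏ j ∈ Finset.Ioi i, (X j - X i) := by
  refine ⟨Equiv.Perm.sign (Fin.revPerm : Equiv.Perm (Fin n)), ?_⟩
  rw [← Matrix.det_vandermonde, ← Matrix.det_permute', vanderPoly, alternant]
  congr 1

theorem eval_vanderPoly_ne_zero {n : ℕ} {x : Fin n → ℝ} (hx : Function.Injective x) :
    eval x (vanderPoly n) ≠ 0 := by
  obtain ⟨u, hu⟩ := vanderPoly_eq_prod n
  rw [hu, map_mul, map_prod]
  refine mul_ne_zero ?_ (Finset.prod_ne_zero_iff.2 fun i _ => ?_)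
  · rcases Int.units_eq_one_or u with h | h <;> simp [h]
  · rw [map_prod]
    refine Finset.prod_ne_zero_iff.2 fun j hj => ?_
    have : i ≠ j := (Finset.mem_Ioi.1 hj).ne
    simpa [sub_eq_zero] using fun h => this (hx h).symm

theorem eval_vanderPoly_eq_zero {n : ℕ} {x : Fin n → ℝ} (hx : ¬ Function.Injective x) :
    eval x (vanderPoly n) = 0 := by
  simp only [Function.Injective, not_forall] at hx
  obtain ⟨i, j, hij, hne⟩ := hx
  rw [vanderPoly, alternant, RingHom.map_det]
  refine Matrix.det_zero_of_row_eq hne ?_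
  funext k
  simp [hij]

/-- Logarithmic derivative of the product: each j ≠ i shares exactly one factor with i, and the sign
of that factor cancels. -/
theorem eval_pderiv_vanderPoly {n : ℕ} {x : Fin n → ℝ} (hx : Function.Injective x) (i : Fin n) :
    eval x (pderiv i (vanderPoly n)) =
      eval x (vanderPoly n) * ∑ j ∈ Finset.univ.erase i, 1 / (x i - x j) := by
  obtain ⟨u, hu⟩ := vanderPoly_eq_prod n
  have h1 : ∀ a b : Fin n, a ≠ b → x b - x a ≠ 0 := fun a b hab =>
    sub_ne_zero.2 fun h => hab (hx h).symm
  rw [hu, ← map_intCast (C : ℝ →+* MvPolynomial (Fin n) ℝ), pderiv_C_mul, map_mul, map_mul,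
    mul_assoc, Finset.prod_sigma', eval_pderiv_prod]
  · congr 2
    rw [Finset.sum_sigma]
    have h2 : ∀ a : Fin n, ∑ b ∈ Finset.Ioi a,
        eval x (pderiv i (X b - X a)) / eval x (X b - X a : MvPolynomial (Fin n) ℝ) =
        (if a < i then 1 / (x i - x a) else 0) +
          if a = i then ∑ b ∈ Finset.Ioi i, 1 / (x i - x b) else 0 := by
      intro a
      have h3 : ∀ b ∈ Finset.Ioi a,
          eval x (pderiv i (X b - X a)) / eval x (X b - X a : MvPolynomial (Fin n) ℝ) =
          (if b = i then 1 / (x i - x a) else 0) + if a = i then 1 / (x i - x b) else 0 := by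
        intro b hb
        have hab : a ≠ b := (Finset.mem_Ioi.1 hb).ne
        simp only [map_sub, pderiv_X, Pi.single_apply, eval_X]
        by_cases hb' : b = i
        · subst hb'
          have : b ≠ a := hab.symm
          simp [hab]
        · by_cases ha' : a = i
          · subst ha'
            simp only [hb', if_true, if_false, map_zero, map_one, zero_sub, zero_add]
            rw [← neg_sub (x b), div_neg, neg_div]
          · simp [hb', ha']
      rw [Finset.sum_congr rfl h3, Finset.sum_add_distrib, Finset.sum_ite_eq']
      congr 1
      · simp only [Finset.mem_Ioi]
      · split_ifs with h
        · rw [h]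
        · simp
    rw [Finset.sum_congr rfl fun a _ => h2 a, Finset.sum_add_distrib, Finset.sum_ite_eq',
      if_pos (Finset.mem_univ i), ← Finset.sum_filter]
    have h4 : Finset.univ.erase i = Finset.univ.filter (· < i) ∪ Finset.Ioi i := by
      ext j
      simp
    rw [h4, Finset.sum_union]
    rw [Finset.disjoint_left]
    intro j h5 h6
    exact absurd (Finset.mem_Ioi.1 h6) (not_lt.2 (Finset.mem_filter.1 h5).2.le)
  · rintro ⟨a, b⟩ hab
    simp only [Finset.mem_sigma, Finset.mem_Ioi] at hab
    simpa using h1 a b hab.2.ne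

/-- For `α = 1` the Laplace-Beltrami operator is conjugate to `∑ᵢ xᵢ² ∂ᵢ²`, up to a constant. -/
theorem eval_vanderPoly_mul_jackOperator {n : ℕ} (f : MvPolynomial (Fin n) ℝ) {x : Fin n → ℝ}
    (hx : Function.Injective x) :
    eval x (vanderPoly n) * jackOperator 1 f x = eval x (eulerSq (vanderPoly n * f)) -
      (∑ i : Fin n, ((i.rev : ℕ) : ℝ) * (((i.rev : ℕ) : ℝ) - 1)) *
        (eval x (vanderPoly n) * eval x f) := by
  -- Second-order Leibniz rule. The cross term becomes the first-order part of the operator, and the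
  -- last term a constant multiple, as the Vandermonde is an eigenvector.
  have h1 : eulerSq (vanderPoly n * f) =
      vanderPoly n * ∑ i, X i ^ 2 * pderiv i (pderiv i f) +
      2 * ∑ i, X i ^ 2 * (pderiv i (vanderPoly n) * pderiv i f) +
      eulerSq (vanderPoly n) * f := by
    simp only [eulerSq, Finset.mul_sum, Finset.sum_mul, ← Finset.sum_add_distrib]
    refine Finset.sum_congr rfl fun i _ => ?_
    simp only [Derivation.leibniz, map_add, smul_eq_mul]
    ring
  have h2 : eval x (eulerSq (vanderPoly n)) =
      (∑ i : Fin n, ((i.rev : ℕ) : ℝ) * (((i.rev : ℕ) : ℝ) - 1)) * eval x (vanderPoly n) := by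
    conv_lhs => rw [vanderPoly, eulerSq_alternant, map_mul, eval_C, ← vanderPoly]
  have h3 : eval x (2 * ∑ i, X i ^ 2 * (pderiv i (vanderPoly n) * pderiv i f)) =
      eval x (vanderPoly n) * (2 * ∑ i, ∑ j ∈ Finset.univ.erase i,
        x i ^ 2 / (x i - x j) * eval x (pderiv i f)) := by
    rw [map_mul, map_sum, mul_left_comm]
    congr 1
    · simp
    rw [Finset.mul_sum]
    refine Finset.sum_congr rfl fun i _ => ?_
    rw [map_mul, map_mul, eval_pderiv_vanderPoly hx, map_pow, eval_X, Finset.mul_sum,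
      Finset.mul_sum, Finset.sum_mul, Finset.mul_sum]
    exact Finset.sum_congr rfl fun j _ => by ring
  rw [h1, map_add, map_add, map_mul (eval x) (eulerSq _), h2, h3, map_mul, map_sum, jackOperator]
  simp only [map_mul, map_pow, eval_X, div_one]
  ring

theorem jackOperator_eigen_iff {n : ℕ} (f : MvPolynomial (Fin n) ℝ) (c : ℝ) :
    (∀ x : Fin n → ℝ, Function.Injective x → jackOperator 1 f x = c * eval x f) ↔
      eulerSq (vanderPoly n * f) =
        C (c + ∑ i : Fin n, ((i.rev : ℕ) : ℝ) * (((i.rev : ℕ) : ℝ) - 1)) * (vanderPoly n * f) := by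
  constructor
  · intro h
    -- The eigenvalue equation is known only at points with distinct coordinates; an extra
    -- Vandermonde factor makes both sides vanish at the others.
    refine mul_left_cancel₀ (vanderPoly_ne_zero n) (MvPolynomial.funext fun x => ?_)
    by_cases hx : Function.Injective x
    · have h1 := eval_vanderPoly_mul_jackOperator f hx
      rw [h x hx] at h1
      simp only [map_mul, eval_C] at h1 ⊢
      linear_combination (-(eval x (vanderPoly n))) * h1
    · rw [map_mul, map_mul _ (vanderPoly n), eval_vanderPoly_eq_zero hx, zero_mul, zero_mul]
  · intro h x hx
    have h1 := eval_vanderPoly_mul_jackOperator f hx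
    rw [h] at h1
    simp only [map_mul, eval_C] at h1
    refine mul_left_cancel₀ (eval_vanderPoly_ne_zero hx) ?_
    rw [h1]
    ring

theorem sum_sq_eq_of_eigen {n k : ℕ} {g : MvPolynomial (Fin n) ℝ} {c : ℝ}
    (hg : eulerSq g = C c * g) {m : Fin n → ℕ} (hm : coeff (toExp m) g ≠ 0)
    (hk : ∑ i, m i = k) : c = ∑ i, (m i : ℝ) ^ 2 - k := by
  have h1 := congrArg (coeff (toExp m)) hg
  rw [coeff_eulerSq, coeff_C_mul] at h1
  rw [← mul_right_cancel₀ hm h1, ← hk]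
  push_cast
  rw [← Finset.sum_sub_distrib]
  exact Finset.sum_congr rfl fun i _ => by ring

end Operator

/-! ### Triangularity and identification of the Jack polynomials at α = 1 -/

section Dominance

open MvPolynomial

/-- With δ = (n-1, …, 0) the exponent is μ + δ - δ∘w. Since δ dominates its rearrangements, the
partial sums are at least those of μ, and sorting only raises them. Equality forces δ∘w = δ. -/
theorem exists_perm_dominating {n : ℕ} {μ : Fin n → ℕ} (w : Equiv.Perm (Fin n))
    (hw : (fun j : Fin n => (j.rev : ℕ)) ∘ w ≤ stair μ) :
    ∃ t : Equiv.Perm (Fin n),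
      Antitone ((stair μ - (fun j : Fin n => (j.rev : ℕ)) ∘ w) ∘ t) ∧
      ∑ i, ((stair μ - (fun j : Fin n => (j.rev : ℕ)) ∘ w) ∘ t) i = ∑ i, μ i ∧
      DominatedBy μ ((stair μ - (fun j : Fin n => (j.rev : ℕ)) ∘ w) ∘ t) ∧
      ((stair μ - (fun j : Fin n => (j.rev : ℕ)) ∘ w) ∘ t = μ → w = 1) := by
  set δ : Fin n → ℕ := fun j : Fin n => (j.rev : ℕ)
  set m := stair μ - δ ∘ w with hm
  obtain ⟨t, ht⟩ := exists_perm_antitone m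
  have hadd : ∀ s : Finset (Fin n), ∑ i ∈ s, m i + ∑ i ∈ s, (δ ∘ w) i =
      ∑ i ∈ s, μ i + ∑ i ∈ s, δ i := fun s => by
    rw [← Finset.sum_add_distrib, ← Finset.sum_add_distrib]
    exact Finset.sum_congr rfl fun i _ => Nat.sub_add_cancel (hw i)
  have hδ : DominatedBy (δ ∘ w) δ := dominatedBy_comp_perm rev_strictAnti.antitone w
  have hmt : DominatedBy m (m ∘ t) := by
    have := dominatedBy_comp_perm ht t.symm
    have h2 : (m ∘ t) ∘ t.symm = m := by funext i; simp
    rwa [h2] at this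
  refine ⟨t, ht, ?_, fun j => ?_, fun h => ?_⟩
  · have h1 := hadd Finset.univ
    have h2 : ∑ i, (δ ∘ w) i = ∑ i, δ i := Equiv.sum_comp w δ
    have h3 : ∑ i, (m ∘ t) i = ∑ i, m i := Equiv.sum_comp t m
    omega
  · have h1 := hadd (Finset.Iic j)
    have h2 := hδ j
    have h3 := hmt j
    omega
  · refine strictAnti_comp_perm (l := δ) rev_strictAnti rev_strictAnti
      (hδ.antisymm fun j => ?_)
    have h1 := hadd (Finset.Iic j)
    have h3 := hmt j
    rw [h] at h3
    change ∑ i ∈ Finset.Iic j, δ i ≤ _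
    omega

/-- A nonzero coefficient of an alternating polynomial comes from a dominating one of the
symmetric quotient. -/
theorem exists_dominating_of_coeff_ne_zero {n k : ℕ} {f : MvPolynomial (Fin n) ℝ}
    (hf : f.IsSymmetric) {μ : Fin n → ℕ} (hμ : μ ∈ partitionsOf n k)
    (h : coeff (toExp (stair μ)) (vanderPoly n * f) ≠ 0) :
    ∃ ν ∈ partitionsOf n k, coeff (toExp ν) f ≠ 0 ∧ DominatedBy μ ν := by
  rw [vanderPoly, coeff_alternant_mul] at h
  obtain ⟨w, _, hw⟩ := Finset.exists_ne_zero_of_sum_ne_zero h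
  split_ifs at hw with hle
  · obtain ⟨t, h1, h2, h3, -⟩ := exists_perm_dominating w hle
    refine ⟨_, mem_partitionsOf.2 ⟨h2.trans (mem_partitionsOf.1 hμ).1, h1⟩, ?_, h3⟩
    rw [hf.coeff_comp_perm]
    exact right_ne_zero_of_mul hw
  · exact absurd rfl hw

/-- In the expansion over permutations, every w ≠ 1 sees a coefficient of f whose sorted exponent
strictly dominates μ, hence 0. -/
theorem coeff_stair_of_maximal {n k : ℕ} {f : MvPolynomial (Fin n) ℝ} (hf : f.IsSymmetric)
    {μ : Fin n → ℕ} (hμ : μ ∈ partitionsOf n k)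
    (h : ∀ ν ∈ partitionsOf n k, coeff (toExp ν) f ≠ 0 → DominatedBy μ ν → ν = μ) :
    coeff (toExp (stair μ)) (vanderPoly n * f) = coeff (toExp μ) f := by
  rw [vanderPoly, coeff_alternant_mul, Finset.sum_eq_single 1]
  · have hle : (fun j : Fin n => (j.rev : ℕ)) ∘ (1 : Equiv.Perm (Fin n)) ≤ stair μ :=
      fun i => Nat.le_add_left _ _
    rw [if_pos hle]
    simp only [Equiv.Perm.sign_one, Units.val_one, Int.cast_one, one_mul]
    congr 2
    funext i
    simp [stair]
  · intro w _ hw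
    split_ifs with hle
    · obtain ⟨t, h1, h2, h3, h4⟩ := exists_perm_dominating w hle
      by_contra h0
      refine hw (h4 (h _ (mem_partitionsOf.2 ⟨h2.trans (mem_partitionsOf.1 hμ).1, h1⟩) ?_ h3))
      rw [hf.coeff_comp_perm]
      exact right_ne_zero_of_mul h0
    · rfl
  · simp

/-- Among the exponents of s_κ dominating μ, one with the largest sum of squares is maximal for
dominance. It therefore survives in the alternant of κ, which has only one decreasing exponent, and
so equals κ. -/
theorem schurPoly_triangular {n k : ℕ} {κ μ : Fin n → ℕ} (hκ : κ ∈ partitionsOf n k)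
    (hμ : μ ∈ partitionsOf n k) (h : coeff (toExp μ) (schurPoly κ) ≠ 0) : DominatedBy μ κ := by
  classical
  obtain ⟨ν, hν, hmax⟩ := Finset.exists_max_image ((partitionsOf n k).filter fun ν =>
      coeff (toExp ν) (schurPoly κ) ≠ 0 ∧ DominatedBy μ ν) (fun ν => ∑ i, stair ν i ^ 2)
    ⟨μ, Finset.mem_filter.2 ⟨hμ, h, fun _ => le_rfl⟩⟩
  simp only [Finset.mem_filter] at hν hmax
  obtain ⟨hν, hν0, hμν⟩ := hν
  have h1 := coeff_stair_of_maximal (schurPoly_isSymmetric κ) hν fun ν' h' h0 hd =>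
    (eq_of_dominatedBy_of_sum_sq_le (mem_partitionsOf.1 h').2 (mem_partitionsOf.1 hν).2
      ((mem_partitionsOf.1 hν).1.trans (mem_partitionsOf.1 h').1.symm) hd
      (hmax ν' ⟨h', h0, hμν.trans hd⟩)).symm
  rw [vanderPoly_mul_schurPoly, coeff_alternant (stair_strictAnti (mem_partitionsOf.1 hκ).2)
    (stair_strictAnti (mem_partitionsOf.1 hν).2)] at h1
  by_cases he : stair κ = stair ν
  · rwa [stair_injective he]
  · rw [if_neg he] at h1
    exact absurd h1.symm hν0

theorem schurPoly_leading {n k : ℕ} {κ : Fin n → ℕ} (hκ : κ ∈ partitionsOf n k) :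
    coeff (toExp κ) (schurPoly κ) ≠ 0 := by
  have hs := stair_strictAnti (mem_partitionsOf.1 hκ).2
  obtain ⟨ν, hν, h0, hd⟩ := exists_dominating_of_coeff_ne_zero (schurPoly_isSymmetric κ) hκ (by
    rw [vanderPoly_mul_schurPoly, coeff_alternant hs hs, if_pos rfl]
    exact one_ne_zero)
  have := hd.antisymm (schurPoly_triangular hκ hν h0)
  subst this
  exact h0

/-- For `α = 1`, the eigenfunctions with highest term `κ` are the multiples of the Schur
polynomial. -/
theorem eq_C_mul_schurPoly {n k : ℕ} {f : MvPolynomial (Fin n) ℝ} (hf : f.IsSymmetric)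
    (hk : f.IsHomogeneous k) {κ : Fin n → ℕ} (hκ : κ ∈ partitionsOf n k)
    (hlead : coeff (toExp κ) f ≠ 0)
    (htri : ∀ μ ∈ partitionsOf n k, coeff (toExp μ) f ≠ 0 → DominatedBy μ κ)
    (heig : ∃ c : ℝ, ∀ x : Fin n → ℝ, Function.Injective x →
      jackOperator 1 f x = c * eval x f) : ∃ c : ℝ, f = C c * schurPoly κ := by
  obtain ⟨c, hc⟩ := heig
  rw [jackOperator_eigen_iff] at hc
  have hκ0 : coeff (toExp (stair κ)) (vanderPoly n * f) ≠ 0 := by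
    rw [coeff_stair_of_maximal hf hκ fun ν hν h0 hd => (htri ν hν h0).antisymm hd]
    exact hlead
  have hdeg : ∀ {μ}, μ ∈ partitionsOf n k →
      ∑ i, stair μ i = k + ∑ i : Fin n, (i.rev : ℕ) := fun hμ => by
    rw [sum_stair, (mem_partitionsOf.1 hμ).1]
  refine ⟨coeff (toExp (stair κ)) (vanderPoly n * f), ?_⟩
  conv_lhs => rw [eq_sum_schurPoly hf hk]
  refine Finset.sum_eq_single_of_mem κ hκ fun μ hμ hne => ?_
  suffices coeff (toExp (stair μ)) (vanderPoly n * f) = 0 by rw [this, map_zero, zero_mul]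
  -- A Schur polynomial of μ occurring in f has the eigenvalue of κ, so the sums of squares agree;
  -- as κ dominates μ, this gives μ = κ.
  by_contra h0
  obtain ⟨ν, hν, hν0, hd⟩ := exists_dominating_of_coeff_ne_zero hf hμ h0
  have h1 := sum_sq_eq_of_eigen hc hκ0 (hdeg hκ)
  have h2 := sum_sq_eq_of_eigen hc h0 (hdeg hμ)
  refine hne (eq_of_dominatedBy_of_sum_sq_le (mem_partitionsOf.1 hκ).2 (mem_partitionsOf.1 hμ).2
    ((mem_partitionsOf.1 hμ).1.trans (mem_partitionsOf.1 hκ).1.symm) (hd.trans (htri ν hν hν0)) ?_)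
  have h3 : ∑ i, (stair κ i : ℝ) ^ 2 = ∑ i, (stair μ i : ℝ) ^ 2 := by linarith
  exact le_of_eq (by exact_mod_cast h3)

theorem schurPoly_eigenfunction {n : ℕ} (κ : Fin n → ℕ) :
    ∃ c : ℝ, ∀ x : Fin n → ℝ, Function.Injective x →
      jackOperator 1 (schurPoly κ) x = c * eval x (schurPoly κ) := by
  refine ⟨(∑ i, (stair κ i : ℝ) * (stair κ i - 1)) -
    ∑ i : Fin n, ((i.rev : ℕ) : ℝ) * (((i.rev : ℕ) : ℝ) - 1), ?_⟩
  rw [jackOperator_eigen_iff, sub_add_cancel, vanderPoly_mul_schurPoly, eulerSq_alternant]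

/-- The coefficient of the Schur polynomial of `κ` in `(x₁ + ⋯ + xₙ) ^ k`. -/
noncomputable def powerCoeff {n : ℕ} (κ : Fin n → ℕ) : ℝ :=
  coeff (toExp (stair κ)) (vanderPoly n * (∑ i, X i) ^ ∑ i, κ i)

theorem sum_X_pow_eq (n k : ℕ) : ((∑ i, X i) ^ k : MvPolynomial (Fin n) ℝ) =
    ∑ κ ∈ partitionsOf n k, C (powerCoeff κ) * schurPoly κ := by
  have hs : ((∑ i, X i) ^ k : MvPolynomial (Fin n) ℝ).IsSymmetric := by
    intro w
    rw [map_pow, map_sum]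
    congr 1
    simpa using Equiv.sum_comp w fun i => (X i : MvPolynomial (Fin n) ℝ)
  have hk : ((∑ i, X i) ^ k : MvPolynomial (Fin n) ℝ).IsHomogeneous k := by
    simpa using (IsHomogeneous.sum Finset.univ (fun i => (X i : MvPolynomial (Fin n) ℝ)) 1
      fun i _ => isHomogeneous_X ℝ i).pow k
  conv_lhs => rw [eq_sum_schurPoly hs hk]
  refine Finset.sum_congr rfl fun κ hκ => ?_
  rw [powerCoeff, (mem_partitionsOf.1 hκ).1]

theorem multinomial_coeff {n k : ℕ} (m : Fin n → ℕ) :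
    coeff (toExp m) ((∑ i, X i) ^ k : MvPolynomial (Fin n) ℝ) =
      if ∑ i, m i = k then (k.factorial : ℝ) / ∏ i, ((m i).factorial : ℝ) else 0 := by
  rw [Finset.sum_pow_eq_sum_piAntidiag, coeff_sum]
  have h1 : ∀ l ∈ Finset.piAntidiag Finset.univ k, coeff (toExp m)
      ((Nat.multinomial Finset.univ l : MvPolynomial (Fin n) ℝ) * ∏ i, X i ^ l i) =
      if l = m then (Nat.multinomial Finset.univ l : ℝ) else 0 := by
    intro l _
    have h2 : (∏ i, X i ^ l i : MvPolynomial (Fin n) ℝ) = monomial (toExp l) 1 := by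
      rw [monomial_eq, Finsupp.prod_fintype _ _ (by simp)]
      simp
    rw [h2, ← map_natCast (C : ℝ →+* MvPolynomial (Fin n) ℝ), coeff_C_mul, coeff_monomial]
    simp [toExp_injective.eq_iff]
  rw [Finset.sum_congr rfl h1, Finset.sum_ite_eq']
  have h3 : m ∈ Finset.piAntidiag Finset.univ k ↔ ∑ i, m i = k := by simp
  simp only [h3]
  split_ifs with h
  · have := Nat.multinomial_spec (s := Finset.univ) (f := m)
    rw [h] at this
    rw [eq_div_iff, mul_comm]
    · exact_mod_cast this
    · exact Finset.prod_ne_zero_iff.2 fun i _ => by positivity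
  · rfl

/-- Expand over permutations: each multinomial coefficient k!/∏ (l_i - δ_{w(i)})! is k!/∏ l_i! times
a product of falling factorials. Those falling factorials vanish exactly when an exponent would be
negative. -/
theorem powerCoeff_eq_det {n : ℕ} (κ : Fin n → ℕ) :
    powerCoeff κ * ∏ i, ((stair κ i).factorial : ℝ) = ((∑ i, κ i).factorial : ℝ) *
      Matrix.det (Matrix.of fun i j : Fin n =>
        ((stair κ j).descFactorial (i.rev : ℕ) : ℝ)) := by
  rw [powerCoeff, vanderPoly, coeff_alternant_mul, Matrix.det_apply', Finset.sum_mul,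
    Finset.mul_sum]
  refine Finset.sum_congr rfl fun w _ => ?_
  simp only [Matrix.of_apply]
  split_ifs with h
  · rw [multinomial_coeff, if_pos]
    · have h1 : ∀ i, ((stair κ i).descFactorial ((w i).rev : ℕ) : ℝ) =
          ((stair κ i).factorial : ℝ) / ((stair κ i - ((w i).rev : ℕ)).factorial : ℝ) := by
        intro i
        rw [eq_div_iff (by positivity), mul_comm]
        exact_mod_cast Nat.factorial_mul_descFactorial (h i)
      simp only [h1, Finset.prod_div_distrib, Pi.sub_apply, Function.comp_apply]
      ring
    · have h1 : ∑ i, (stair κ - (fun j : Fin n => (j.rev : ℕ)) ∘ w) i +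
          ∑ i, ((fun j : Fin n => (j.rev : ℕ)) ∘ w) i = ∑ i, stair κ i := by
        rw [← Finset.sum_add_distrib]
        exact Finset.sum_congr rfl fun i _ => Nat.sub_add_cancel (h i)
      have h2 : ∑ i, ((fun j : Fin n => (j.rev : ℕ)) ∘ w) i = ∑ i : Fin n, (i.rev : ℕ) :=
        Equiv.sum_comp w fun j : Fin n => (j.rev : ℕ)
      rw [sum_stair, h2] at h1
      omega
  · rw [Pi.le_def, not_forall] at h
    obtain ⟨i, hi⟩ := h
    rw [zero_mul, Finset.prod_eq_zero (Finset.mem_univ i), mul_zero, mul_zero]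
    rw [Nat.cast_eq_zero, Nat.descFactorial_eq_zero_iff_lt]
    exact not_le.1 hi

theorem powerCoeff_ne_zero {n : ℕ} {κ : Fin n → ℕ} (hκ : Antitone κ) : powerCoeff κ ≠ 0 := by
  have h := powerCoeff_eq_det κ
  intro h0
  rw [h0, zero_mul] at h
  exact mul_ne_zero (by positivity)
    (det_descFactorial_ne_zero (stair_strictAnti hκ).injective) h.symm

theorem schur_isJackFamily (n k : ℕ) :
    IsJackFamily 1 n k fun κ => C (powerCoeff κ) * schurPoly κ where
  symmetric κ _ w := by rw [map_mul, rename_C, schurPoly_isSymmetric κ w]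
  homogeneous κ hκ := by
    rw [← (mem_partitionsOf.1 hκ).1]
    exact (schurPoly_isHomogeneous κ).C_mul _
  leading κ hκ := by
    rw [coeff_C_mul]
    exact mul_ne_zero (powerCoeff_ne_zero (mem_partitionsOf.1 hκ).2) (schurPoly_leading hκ)
  triangular κ hκ μ hμ h := by
    rw [coeff_C_mul] at h
    exact schurPoly_triangular hκ hμ (right_ne_zero_of_mul h)
  eigenfunction κ _ := by
    obtain ⟨c, hc⟩ := schurPoly_eigenfunction κ
    rw [jackOperator_eigen_iff] at hc
    refine ⟨c, ?_⟩
    rw [jackOperator_eigen_iff, mul_left_comm, eulerSq_C_mul, hc, mul_left_comm]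
  sum_eq := (sum_X_pow_eq n k).symm

/-- For `α = 1` the Jack polynomials are multiples of the Schur polynomials. -/
theorem jackC_one {n : ℕ} {κ : Fin n → ℕ} (hκ : Antitone κ) :
    jackC 1 κ = C (powerCoeff κ) * schurPoly κ := by
  set k := ∑ i, κ i
  have hex : ∃ F, IsJackFamily 1 n k F := ⟨_, schur_isJackFamily n k⟩
  have hF := hex.choose_spec
  set F := hex.choose with hFdef
  have h1 : ∀ μ ∈ partitionsOf n k, ∃ c, F μ = C c * schurPoly μ := fun μ hμ =>
    eq_C_mul_schurPoly (hF.symmetric μ hμ) (hF.homogeneous μ hμ) hμ (hF.leading μ hμ)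
      (hF.triangular μ hμ) (hF.eigenfunction μ hμ)
  choose! c hc using h1
  have hmem : κ ∈ partitionsOf n k := mem_partitionsOf.2 ⟨rfl, hκ⟩
  have h2 : ∑ μ ∈ partitionsOf n k, C (c μ) * schurPoly μ =
      ∑ μ ∈ partitionsOf n k, C (powerCoeff μ) * schurPoly μ := by
    rw [← sum_X_pow_eq, ← hF.sum_eq]
    exact Finset.sum_congr rfl fun μ hμ => (hc μ hμ).symm
  -- The coefficient at the decreasing exponent of κ isolates the κ-term, so the two expansions of
  -- the power sum have equal scalars.
  have h3 : ∀ d : (Fin n → ℕ) → ℝ, coeff (toExp (stair κ)) (vanderPoly n *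
      ∑ μ ∈ partitionsOf n k, C (d μ) * schurPoly μ) = d κ := by
    intro d
    rw [Finset.mul_sum, coeff_sum, Finset.sum_eq_single_of_mem κ hmem]
    · rw [mul_left_comm, coeff_C_mul, vanderPoly_mul_schurPoly,
        coeff_alternant (stair_strictAnti hκ) (stair_strictAnti hκ), if_pos rfl, mul_one]
    · intro μ hμ hne
      rw [mul_left_comm, coeff_C_mul, vanderPoly_mul_schurPoly,
        coeff_alternant (stair_strictAnti (mem_partitionsOf.1 hμ).2) (stair_strictAnti hκ),
        if_neg fun h => hne (stair_injective h), mul_zero]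
  have h4 : c κ = powerCoeff κ := by rw [← h3 c, h2, h3]
  rw [jackC, dif_pos hex, ← h4]
  exact hc κ hmem

/-- The value of the normalized product of Jack polynomials for `α = 1`. -/
theorem jackC_one_mul_div {n : ℕ} {κ : Fin n → ℕ} (hκ : Antitone κ) (x y : Fin n → ℂ) :
    aeval x (jackC 1 κ) * aeval y (jackC 1 κ) / aeval (fun _ => (1 : ℂ)) (jackC 1 κ) =
      ((∑ i, κ i).factorial : ℂ) * ((∏ i : Fin n, ((i.rev : ℕ).factorial : ℂ)) /
        ∏ i, ((stair κ i).factorial : ℂ)) * (schurEval x (stair κ) * schurEval y (stair κ)) := by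
  have hev : ∀ z : Fin n → ℂ, aeval z (jackC 1 κ) =
      (powerCoeff κ : ℂ) * schurEval z (stair κ) := by
    intro z
    have := map_schurEval (aeval z : MvPolynomial (Fin n) ℝ →ₐ[ℝ] ℂ).toRingHom X (stair κ)
    simp only [AlgHom.toRingHom_eq_coe, RingHom.coe_coe, aeval_X] at this
    rw [jackC_one hκ, map_mul, schurPoly, this, aeval_C]
    rfl
  have hone : schurEval (fun _ : Fin n => (1 : ℂ)) (stair κ) =
      ((schurEval (fun _ : Fin n => (1 : ℝ)) (stair κ) : ℝ) : ℂ) := by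
    have := map_schurEval Complex.ofRealHom (fun _ : Fin n => (1 : ℝ)) (stair κ)
    simpa using this.symm
  -- One factor `powerCoeff κ` and s_κ(1, …, 1) survive in the quotient; after the rewriting this
  -- relation evaluates their ratio.
  have h1 := powerCoeff_eq_det κ
  rw [det_descFactorial_eq, det_descFactorial_rev] at h1
  have h2 : schurEval (fun _ : Fin n => (1 : ℝ)) (stair κ) ≠ 0 := by
    have := det_descFactorial_ne_zero (stair_strictAnti hκ).injective
    rw [det_descFactorial_eq] at this
    exact right_ne_zero_of_mul this
  have h3 : (powerCoeff κ : ℂ) ≠ 0 := by exact_mod_cast powerCoeff_ne_zero hκ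
  have h5 : (∏ i, ((stair κ i).factorial : ℂ)) ≠ 0 :=
    Finset.prod_ne_zero_iff.2 fun i _ => by exact_mod_cast Nat.factorial_ne_zero _
  have h4 : (powerCoeff κ : ℂ) * ∏ i, ((stair κ i).factorial : ℂ) =
      ((∑ i, κ i).factorial : ℂ) * ((∏ i : Fin n, ((i.rev : ℕ).factorial : ℂ)) *
        ((schurEval (fun _ : Fin n => (1 : ℝ)) (stair κ) : ℝ) : ℂ)) := by exact_mod_cast h1
  have h6 : ((schurEval (fun _ : Fin n => (1 : ℝ)) (stair κ) : ℝ) : ℂ) ≠ 0 := by exact_mod_cast h2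
  rw [hev, hev, hev, hone, div_eq_iff (mul_ne_zero h3 h6)]
  field_simp
  linear_combination schurEval x (stair κ) * schurEval y (stair κ) * h4

end Dominance

/-! ### Cauchy-Binet for series -/

section CauchyBinet

/-- Absolute summability is carried through the induction because the product of two series requires
it. -/
theorem hasSum_pi_prod : ∀ {n : ℕ} (F : Fin n → ℕ → ℂ), (∀ i, Summable fun l => ‖F i l‖) →
    HasSum (fun l : Fin n → ℕ => ∏ i, F i (l i)) (∏ i, ∑' l, F i l) ∧
      Summable fun l : Fin n → ℕ => ‖∏ i, F i (l i)‖ := by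
  intro n
  induction n with
  | zero =>
    intro F _
    simp only [Finset.univ_eq_empty, Finset.prod_empty]
    exact ⟨hasSum_unique _, Summable.of_finite⟩
  | succ n ih =>
    intro F hF
    obtain ⟨h1, h2⟩ := ih (fun i => F i.succ) fun i => hF i.succ
    have hs := (hF 0).mul_norm h2
    have he : (fun l : Fin (n + 1) → ℕ => ∏ i, F i (l i)) ∘ Fin.consEquiv (fun _ => ℕ) =
        fun p : ℕ × (Fin n → ℕ) => F 0 p.1 * ∏ i, F i.succ (p.2 i) := by
      funext p
      simp [Fin.prod_univ_succ, Fin.consEquiv]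
    constructor
    · rw [← (Fin.consEquiv fun _ => ℕ).hasSum_iff, he, Fin.prod_univ_succ, ← h1.tsum_eq,
        tsum_mul_tsum_of_summable_norm (hF 0) h2]
      exact hs.of_norm.hasSum
    · rw [← (Fin.consEquiv fun _ => ℕ).summable_iff]
      refine hs.congr fun p => ?_
      exact congrArg norm (congrFun he p).symm

/-- The Cauchy-Binet formula for series, arranged by partitions. -/
theorem hasSum_cauchyBinet {n : ℕ} (c : ℕ → ℂ) (u v : Fin n → ℕ → ℂ)
    (h : ∀ i k, Summable fun l => ‖c l * u i l * v k l‖) :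
    HasSum (fun k => ∑ κ ∈ partitionsOf n k, (∏ i, c (stair κ i)) *
        Matrix.det (Matrix.of fun i j : Fin n => u i (stair κ j)) *
        Matrix.det (Matrix.of fun i j : Fin n => v i (stair κ j)))
      (Matrix.det (Matrix.of fun i k : Fin n => ∑' l, c l * u i l * v k l)) := by
  -- The product over columns is summed over all of ℕ^n. Tuples with a repetition contribute 0; the
  -- others are uniquely a permutation of some `stair κ`, and summing over the permutations rebuilds
  -- the determinant of u.
  set f : (Fin n → ℕ) → ℂ := fun l => (∏ i, c (l i) * u i (l i)) *
    Matrix.det (Matrix.of fun i j : Fin n => v i (l j)) with hf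
  have h1 : HasSum f (Matrix.det (Matrix.of fun i k : Fin n => ∑' l, c l * u i l * v k l)) := by
    rw [← Matrix.det_transpose, Matrix.det_apply']
    have : f = fun l => ∑ w : Equiv.Perm (Fin n), ((Equiv.Perm.sign w : ℤ) : ℂ) *
        ∏ i, (c (l i) * u i (l i) * v (w i) (l i)) := by
      funext l
      rw [hf]
      simp only [Matrix.det_apply', Finset.mul_sum, Finset.prod_mul_distrib, Matrix.of_apply]
      exact Finset.sum_congr rfl fun w _ => by ring
    rw [this]
    refine hasSum_sum fun w _ => HasSum.mul_left _ ?_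
    exact (hasSum_pi_prod (fun i l => c l * u i l * v (w i) l) fun i => h i (w i)).1
  set g : (Σ k, ↥(partitionsOf n k) × Equiv.Perm (Fin n)) → (Fin n → ℕ) :=
    fun p => stair (p.2.1 : Fin n → ℕ) ∘ p.2.2 with hg
  have hanti : ∀ {k} (κ : ↥(partitionsOf n k)), Antitone (κ : Fin n → ℕ) :=
    fun κ => (mem_partitionsOf.1 κ.2).2
  have hinj : Function.Injective g := by
    rintro ⟨k, κ, w⟩ ⟨k', κ', w'⟩ he
    have h2 : stair (κ : Fin n → ℕ) ∘ (w * w'⁻¹ : Equiv.Perm (Fin n)) =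
        stair (κ' : Fin n → ℕ) := by
      funext i
      have := congrFun he (w'⁻¹ i)
      simpa [hg] using this
    have h3 := strictAnti_comp_perm (stair_strictAnti (hanti κ)) (stair_strictAnti (hanti κ')) h2
    rw [h3] at h2
    have h4 : (κ : Fin n → ℕ) = κ' := stair_injective h2
    obtain rfl : w = w' := by rwa [mul_inv_eq_one] at h3
    have h5 : k = k' := by
      rw [← (mem_partitionsOf.1 κ.2).1, ← (mem_partitionsOf.1 κ'.2).1, h4]
    subst h5
    rw [Subtype.ext h4]
  have hrange : ∀ l ∉ Set.range g, f l = 0 := by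
    intro l hl
    by_cases hli : Function.Injective l
    · obtain ⟨w, hw⟩ := exists_perm_strictAnti hli
      obtain ⟨κ, hκ, hκl⟩ := exists_stair_eq hw
      refine absurd ⟨⟨∑ i, κ i, ⟨κ, mem_partitionsOf.2 ⟨rfl, hκ⟩⟩, w⁻¹⟩, ?_⟩ hl
      funext i
      simp [hg, hκl]
    · simp only [Function.Injective, not_forall] at hli
      obtain ⟨i, j, hij, hne⟩ := hli
      rw [hf]
      dsimp only
      rw [Matrix.det_zero_of_column_eq hne (fun k => by simp [hij]), mul_zero]
  rw [← hinj.hasSum_iff hrange] at h1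
  have h2 := h1.sigma fun k => hasSum_fintype _
  convert h2 using 2 with k
  rw [Fintype.sum_prod_type, ← Finset.sum_coe_sort]
  refine Finset.sum_congr rfl fun κ _ => ?_
  have h3 : ∀ w : Equiv.Perm (Fin n), (f ∘ g) ⟨k, κ, w⟩ = (∏ i, c (stair (κ : Fin n → ℕ) i)) *
      (((Equiv.Perm.sign w : ℤ) : ℂ) * ∏ i, u i (stair (κ : Fin n → ℕ) (w i))) *
        Matrix.det (Matrix.of fun i j : Fin n => v i (stair (κ : Fin n → ℕ) j)) := by
    intro w
    have h4 := Matrix.det_permute' w (Matrix.of fun i j : Fin n => v i (stair (κ : Fin n → ℕ) j))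
    have h5 : (Matrix.of fun i j : Fin n => v i (stair (κ : Fin n → ℕ) (w j))) =
        (Matrix.of fun i j : Fin n => v i (stair (κ : Fin n → ℕ) j)).submatrix id w := rfl
    simp only [hf, hg, Function.comp_apply]
    rw [h5, h4, Finset.prod_mul_distrib, Equiv.prod_comp w fun i => c (stair (κ : Fin n → ℕ) i)]
    ring
  rw [Finset.sum_congr rfl fun w _ => h3 w, ← Finset.sum_mul, ← Finset.mul_sum,
    ← Matrix.det_transpose (Matrix.of fun i j : Fin n => u i (stair (κ : Fin n → ℕ) j)), Matrix.det_apply']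
  rfl

end CauchyBinet

/-! ### Contour integrals of rational functions and power series -/

section Contours

open MeasureTheory intervalIntegral

variable {z₀ : ℂ} {γ : Path z₀ z₀}

theorem contourIntegral_eq (γ : Path z₀ z₀) (f : ℂ → ℂ) :
    contourIntegral γ f = ∫ t in (0 : ℝ)..1, f (γ.extend t) * deriv γ.extend t := by
  rw [contourIntegral, curveIntegral_eq_intervalIntegral_deriv]
  simp

theorem extend_eq_apply (γ : Path z₀ z₀) (t : ℝ) : ∃ s : I, γ.extend t = γ s :=
  ⟨Set.projIcc 0 1 zero_le_one t, rfl⟩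

/-- Induction on the break points, splitting the interval at one of them. -/
theorem intervalIntegrable_of_forall_disjoint {f : ℝ → ℂ} (P : Finset ℝ) :
    (∀ u v : ℝ, 0 ≤ u → u < v → v ≤ 1 → Disjoint (Set.Ioo u v) (P : Set ℝ) →
      IntervalIntegrable f volume u v) →
    ∀ u v : ℝ, 0 ≤ u → u < v → v ≤ 1 → IntervalIntegrable f volume u v := by
  classical
  induction P using Finset.induction_on with
  | empty => exact fun h u v h1 h2 h3 => h u v h1 h2 h3 (by simp)
  | insert a P _ ih =>
    intro h
    refine ih fun u v h1 h2 h3 hd => ?_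
    have key : ∀ u' v', u ≤ u' → u' < v' → v' ≤ v → a ∉ Set.Ioo u' v' →
        IntervalIntegrable f volume u' v' := fun u' v' hu hlt hv ha =>
      h u' v' (h1.trans hu) hlt (hv.trans h3) (by
        rw [Finset.coe_insert, Set.disjoint_insert_right]
        exact ⟨ha, hd.mono_left (Set.Ioo_subset_Ioo hu hv)⟩)
    by_cases ha : a ∈ Set.Ioo u v
    · exact (key u a le_rfl ha.1 ha.2.le (by simp)).trans (key a v ha.1.le ha.2 le_rfl (by simp))
    · exact key u v le_rfl h2 le_rfl ha

theorem PiecewiseC1.intervalIntegrable_deriv (hγ : PiecewiseC1 γ) :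
    IntervalIntegrable (deriv γ.extend) volume 0 1 := by
  obtain ⟨P, hP⟩ := hγ
  refine intervalIntegrable_of_forall_disjoint P (fun u v h0 huv h1 hd => ?_) 0 1 le_rfl
    zero_lt_one le_rfl
  have h := hP u v h0 huv h1 hd
  have hc := (h.continuousOn_derivWithin (uniqueDiffOn_Icc huv) le_rfl).intervalIntegrable_of_Icc
    (μ := volume) huv.le
  refine hc.congr_ae ?_
  rw [Set.uIoc_of_le huv.le, ← restrict_Ioo_eq_restrict_Ioc]
  filter_upwards [ae_restrict_mem measurableSet_Ioo] with t ht
  exact derivWithin_of_mem_nhds (Icc_mem_nhds ht.1 ht.2)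

theorem PiecewiseC1.exists_finset_hasDerivAt (hγ : PiecewiseC1 γ) : ∃ P : Finset ℝ,
    ∀ t ∈ Set.Ioo (0 : ℝ) 1 \ P, HasDerivAt γ.extend (deriv γ.extend t) t := by
  obtain ⟨P, hP⟩ := hγ
  refine ⟨P, fun t ht => ?_⟩
  have hopen : IsOpen (Set.Ioo (0 : ℝ) 1 \ (P : Set ℝ)) :=
    isOpen_Ioo.sdiff P.finite_toSet.isClosed
  obtain ⟨ε, hε, hb⟩ := Metric.isOpen_iff.1 hopen t ht
  rw [Real.ball_eq_Ioo] at hb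
  have h1 := hb (show t - ε / 2 ∈ Set.Ioo (t - ε) (t + ε) from ⟨by linarith, by linarith⟩)
  have h2 := hb (show t + ε / 2 ∈ Set.Ioo (t - ε) (t + ε) from ⟨by linarith, by linarith⟩)
  have h := hP (t - ε / 2) (t + ε / 2) h1.1.1.le (by linarith) h2.1.2.le (by
    rw [Set.disjoint_left]
    exact fun s hs => (hb ⟨by linarith [hs.1], by linarith [hs.2]⟩).2)
  exact ((h.differentiableOn one_ne_zero).differentiableAt
    (Icc_mem_nhds (by linarith) (by linarith))).hasDerivAt

theorem PiecewiseC1.intervalIntegrable (hγ : PiecewiseC1 γ) {f : ℂ → ℂ}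
    (hf : Continuous fun t : ℝ => f (γ.extend t)) :
    IntervalIntegrable (fun t => f (γ.extend t) * deriv γ.extend t) volume 0 1 :=
  hγ.intervalIntegrable_deriv.continuousOn_mul hf.continuousOn

theorem contourIntegral_add (hγ : PiecewiseC1 γ) {f g : ℂ → ℂ}
    (hf : Continuous fun t : ℝ => f (γ.extend t)) (hg : Continuous fun t : ℝ => g (γ.extend t)) :
    contourIntegral γ (fun z => f z + g z) = contourIntegral γ f + contourIntegral γ g := by
  simp only [contourIntegral_eq, add_mul]
  exact integral_add (hγ.intervalIntegrable hf) (hγ.intervalIntegrable hg)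

theorem contourIntegral_const_mul (c : ℂ) (f : ℂ → ℂ) :
    contourIntegral γ (fun z => c * f z) = c * contourIntegral γ f := by
  simp only [contourIntegral_eq, mul_assoc]
  exact integral_const_mul c _

theorem contourIntegral_congr {f g : ℂ → ℂ} (h : ∀ t, f (γ t) = g (γ t)) :
    contourIntegral γ f = contourIntegral γ g := by
  rw [contourIntegral_eq, contourIntegral_eq]
  congr 1
  funext t
  obtain ⟨s, hs⟩ := extend_eq_apply γ t
  rw [hs, h]

/-- The fundamental theorem of calculus with finitely many exceptional parameters; the path is
closed. The primitive is needed only at points of the path. -/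
theorem contourIntegral_eq_zero_of_hasDerivAt (hγ : PiecewiseC1 γ) {F f : ℂ → ℂ}
    (hf : Continuous fun t : ℝ => f (γ.extend t))
    (hF : ∀ t, HasDerivAt F (f (γ t)) (γ t)) : contourIntegral γ f = 0 := by
  have hF' : ∀ t : ℝ, HasDerivAt F (f (γ.extend t)) (γ.extend t) := fun t => by
    obtain ⟨s, hs⟩ := extend_eq_apply γ t
    rw [hs]
    exact hF s
  obtain ⟨P, hP⟩ := hγ.exists_finset_hasDerivAt
  rw [contourIntegral_eq, integral_eq_of_hasDerivAt_off_countable_of_le (fun t => F (γ.extend t)) _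
    zero_le_one P.countable_toSet _ _ (hγ.intervalIntegrable hf)]
  · simp
  · exact fun t _ => ((hF' t).continuousAt.comp γ.continuous_extend.continuousAt).continuousWithinAt
  · exact fun t ht => (hF' t).comp t (hP t ht)

variable {ι : Type*} {y : ι → ℂ}

theorem continuous_div_prod (hy : ∀ s t, γ t ≠ y s) (S : Finset ι) {f : ℂ → ℂ}
    (hf : Continuous f) : Continuous fun t : ℝ => f (γ.extend t) / ∏ s ∈ S, (γ.extend t - y s) := by
  have h := γ.continuous_extend
  refine (hf.comp h).div (continuous_finsetProd _ fun s _ => h.sub continuous_const) fun t => ?_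
  obtain ⟨t', ht⟩ := extend_eq_apply γ t
  rw [ht]
  exact Finset.prod_ne_zero_iff.2 fun s _ => sub_ne_zero.2 (hy s t')

theorem contourIntegral_polynomial (hγ : PiecewiseC1 γ) (f : Polynomial ℂ) :
    contourIntegral γ (fun z => f.eval z) = 0 := by
  have hc : ∀ g : Polynomial ℂ, Continuous fun t : ℝ => g.eval (γ.extend t) :=
    fun g => g.continuous.comp γ.continuous_extend
  induction f using Polynomial.induction_on' with
  | add f g hf hg =>
    simp only [Polynomial.eval_add]
    rw [contourIntegral_add hγ (hc f) (hc g), hf, hg, add_zero]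
  | monomial m a =>
    refine contourIntegral_eq_zero_of_hasDerivAt hγ (hc _)
      (F := fun z => a / (m + 1) * z ^ (m + 1)) fun t => ?_
    have h := (hasDerivAt_pow (m + 1) (γ t)).const_mul (a / (m + 1))
    refine h.congr_deriv ?_
    have : (m : ℂ) + 1 ≠ 0 := Nat.cast_add_one_ne_zero m
    rw [Polynomial.eval_monomial]
    push_cast
    field_simp

/-- If all the points coincide, the integrand has a primitive. Otherwise partial fractions at two
distinct points leave two products with one factor fewer; when these are single factors, the equal
winding numbers cancel. -/
theorem contourIntegral_one_div_prod (hγ : PiecewiseC1 γ) (hy : ∀ s, Encloses γ (y s)) :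
    ∀ (N : ℕ) (S : Finset ι), S.card = N → 2 ≤ N →
      contourIntegral γ (fun z => 1 / ∏ s ∈ S, (z - y s)) = 0 := by
  classical
  have hc : ∀ S : Finset ι, Continuous fun t : ℝ => 1 / ∏ s ∈ S, (γ.extend t - y s) := fun S =>
    continuous_div_prod (fun s t => (hy s).1 t) S (f := fun _ => 1) continuous_const
  intro N
  induction N with
  | zero => intro S _ h; omega
  | succ N ih =>
    intro S hS hN
    by_cases hall : ∀ i ∈ S, ∀ j ∈ S, y i = y j
    · obtain ⟨i, hi⟩ : S.Nonempty := Finset.card_pos.1 (by omega)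
      refine contourIntegral_eq_zero_of_hasDerivAt hγ (hc S)
        (F := fun z => -(1 / N : ℂ) * ((z - y i) ^ N)⁻¹) fun t => ?_
      have h0 : γ t - y i ≠ 0 := sub_ne_zero.2 ((hy i).1 t)
      have h1 := ((((hasDerivAt_id (γ t)).sub_const (y i)).pow N).inv
        (pow_ne_zero N h0)).const_mul (-(1 / N : ℂ))
      refine HasDerivAt.congr_deriv h1 ?_
      have h2 : ∏ s ∈ S, (γ t - y s) = (γ t - y i) ^ (N + 1) := by
        rw [← hS, ← Finset.prod_const]
        exact Finset.prod_congr rfl fun j hj => by rw [hall j hj i hi]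
      obtain ⟨M, rfl⟩ : ∃ M, N = M + 1 := ⟨N - 1, by omega⟩
      have h3 : ((M + 1 : ℕ) : ℂ) ≠ 0 := Nat.cast_ne_zero.2 (by omega)
      rw [h2]
      simp only [id, Nat.add_sub_cancel, mul_one]
      field_simp
      simp
      ring
    · push Not at hall
      obtain ⟨i, hi, j, hj, hij⟩ := hall
      have hne : i ≠ j := fun h => hij (by rw [h])
      have hsub : y i - y j ≠ 0 := sub_ne_zero.2 hij
      have h1 : contourIntegral γ (fun z => 1 / ∏ s ∈ S, (z - y s)) =
          contourIntegral γ (fun z => 1 / (y i - y j) * (1 / ∏ s ∈ S.erase j, (z - y s)) +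
            -(1 / (y i - y j)) * (1 / ∏ s ∈ S.erase i, (z - y s))) := by
        refine contourIntegral_congr fun t => ?_
        have h0 : ∀ s, γ t - y s ≠ 0 := fun s => sub_ne_zero.2 ((hy s).1 t)
        have hR : ∏ s ∈ (S.erase j).erase i, (γ t - y s) ≠ 0 :=
          Finset.prod_ne_zero_iff.2 fun s _ => h0 s
        rw [← Finset.mul_prod_erase S _ hj, ← Finset.mul_prod_erase (S.erase j) _
          (Finset.mem_erase.2 ⟨hne, hi⟩), ← Finset.mul_prod_erase (S.erase i) _
          (Finset.mem_erase.2 ⟨hne.symm, hj⟩), Finset.erase_right_comm (a := i)]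
        have h2 := h0 i
        have h3 := h0 j
        field_simp
        ring
      rw [h1, contourIntegral_add hγ
          (f := fun z => 1 / (y i - y j) * (1 / ∏ s ∈ S.erase j, (z - y s)))
          (g := fun z => -(1 / (y i - y j)) * (1 / ∏ s ∈ S.erase i, (z - y s)))
          (continuous_const.mul (hc _)) (continuous_const.mul (hc _)),
        contourIntegral_const_mul, contourIntegral_const_mul]
      have hci : (S.erase i).card = N := by rw [Finset.card_erase_of_mem hi]; omega
      have hcj : (S.erase j).card = N := by rw [Finset.card_erase_of_mem hj]; omega
      rcases (show N = 1 ∨ 2 ≤ N by omega) with rfl | hN2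
      · obtain ⟨a, ha⟩ := Finset.card_eq_one.1 hci
        obtain ⟨b, hb⟩ := Finset.card_eq_one.1 hcj
        simp only [ha, hb, Finset.prod_singleton]
        have e1 := (hy a).2
        have e2 := (hy b).2
        have e3 : (1 / (2 * (Real.pi : ℂ) * Complex.I)) ≠ 0 := fun h => by
          rw [h, zero_mul] at e1
          exact zero_ne_one e1
        have e4 := mul_left_cancel₀ e3 (e1.trans e2.symm)
        rw [e4]
        ring
      · rw [ih _ hci hN2, ih _ hcj hN2]
        simp

/-- The residue sum of `z ^ m / ∏ (z - y s)` in low degree. -/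
theorem contourIntegral_pow_div_prod (hγ : PiecewiseC1 γ) (hy : ∀ s, Encloses γ (y s)) :
    ∀ (m : ℕ) (S : Finset ι), m + 1 ≤ S.card →
      1 / (2 * (Real.pi : ℂ) * Complex.I) *
        contourIntegral γ (fun z => z ^ m / ∏ s ∈ S, (z - y s)) =
          if m + 1 = S.card then 1 else 0 := by
  classical
  have hc : ∀ (m : ℕ) (S : Finset ι),
      Continuous fun t : ℝ => γ.extend t ^ m / ∏ s ∈ S, (γ.extend t - y s) := fun m S =>
    continuous_div_prod (fun s t => (hy s).1 t) S (f := fun z => z ^ m) (continuous_pow m)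
  intro m
  induction m with
  | zero =>
    intro S hS
    simp only [pow_zero]
    split_ifs with h
    · obtain ⟨a, rfl⟩ := Finset.card_eq_one.1 (by omega : S.card = 1)
      simpa using (hy a).2
    · rw [contourIntegral_one_div_prod hγ hy _ S rfl (by omega), mul_zero]
  | succ m ih =>
    intro S hS
    obtain ⟨i, hi⟩ : S.Nonempty := Finset.card_pos.1 (by omega)
    -- Write z = (z - y_i) + y_i: one term loses a factor of the denominator, the other a power of
    -- z.
    have h1 : contourIntegral γ (fun z => z ^ (m + 1) / ∏ s ∈ S, (z - y s)) =
        contourIntegral γ (fun z => z ^ m / ∏ s ∈ S.erase i, (z - y s) +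
          y i * (z ^ m / ∏ s ∈ S, (z - y s))) := by
      refine contourIntegral_congr fun t => ?_
      have h0 : ∀ s, γ t - y s ≠ 0 := fun s => sub_ne_zero.2 ((hy s).1 t)
      have hR : ∏ s ∈ S.erase i, (γ t - y s) ≠ 0 := Finset.prod_ne_zero_iff.2 fun s _ => h0 s
      have h2 := h0 i
      rw [← Finset.mul_prod_erase S _ hi]
      field_simp
      ring
    have hci : (S.erase i).card = S.card - 1 := Finset.card_erase_of_mem hi
    rw [h1, contourIntegral_add hγ (f := fun z => z ^ m / ∏ s ∈ S.erase i, (z - y s))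
        (g := fun z => y i * (z ^ m / ∏ s ∈ S, (z - y s)))
        (hc _ _) (continuous_const.mul (hc _ _)),
      contourIntegral_const_mul, mul_add, mul_left_comm, ih S (by omega), if_neg (by omega),
      mul_zero, add_zero, ih _ (by omega)]
    exact if_congr (by omega) rfl rfl

/-- Termwise integration of a power series along a contour. -/
theorem hasSum_contourIntegral (hγ : PiecewiseC1 γ) {c : ℕ → ℂ} {ρ : ℝ}
    (hρ : ∀ t, ‖γ t‖ ≤ ρ) (hc : Summable fun l => ‖c l‖ * ρ ^ l) {g : ℂ → ℂ}
    (hg : Continuous fun t : ℝ => g (γ.extend t)) :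
    HasSum (fun l => c l * contourIntegral γ (fun z => z ^ l * g z))
      (contourIntegral γ fun z => (∑' l, c l * z ^ l) * g z) := by
  have hρ' : ∀ t : ℝ, ‖γ.extend t‖ ≤ ρ := fun t => by
    obtain ⟨s, hs⟩ := extend_eq_apply γ t
    rw [hs]
    exact hρ s
  have hle : ∀ (l : ℕ) (t : ℝ), ‖c l * γ.extend t ^ l‖ ≤ ‖c l‖ * ρ ^ l := fun l t => by
    rw [norm_mul, norm_pow]
    gcongr
    exact hρ' t
  have hgi := hγ.intervalIntegrable hg
  have hcl : ∀ l, Continuous fun t : ℝ => c l * γ.extend t ^ l * g (γ.extend t) := fun l =>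
    (continuous_const.mul (γ.continuous_extend.pow l)).mul hg
  simp only [← contourIntegral_const_mul, ← mul_assoc]
  simp only [contourIntegral_eq]
  refine hasSum_integral_of_dominated_convergence
    (fun l t => ‖c l‖ * ρ ^ l * ‖g (γ.extend t) * deriv γ.extend t‖) (fun l => ?_) (fun l => ?_)
    ?_ ?_ ?_
  · exact (hγ.intervalIntegrable (f := fun z => c l * z ^ l * g z) (hcl l)).def'.aestronglyMeasurable
  · refine Filter.Eventually.of_forall fun t _ => ?_
    rw [mul_assoc, norm_mul]
    gcongr
    exact hle l t
  · exact Filter.Eventually.of_forall fun t _ => hc.mul_right _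
  · simp only [tsum_mul_right]
    exact hgi.norm.const_mul _
  · refine Filter.Eventually.of_forall fun t _ => ?_
    exact (((Summable.of_norm_bounded hc fun l => hle l t).hasSum.mul_right _).mul_right _)

end Contours

/-! ### Coefficients of the scalar series and the constant K -/

section Coefficients

/-- The coefficients of the classical hypergeometric series. -/
noncomputable def scalarCoeff {p q : ℕ} (a : Fin p → ℂ) (b : Fin q → ℂ) (l : ℕ) : ℂ :=
  1 / (l.factorial : ℂ) * ((∏ j, (ascPochhammer ℂ l).eval (a j)) /
    (∏ i, (ascPochhammer ℂ l).eval (b i)))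

theorem scalarCoeff_succ {p q : ℕ} (a : Fin p → ℂ) (b : Fin q → ℂ) (l : ℕ) :
    scalarCoeff a b (l + 1) =
      (∏ j, (a j + l)) / ((∏ i, (b i + l)) * (l + 1)) * scalarCoeff a b l := by
  simp only [scalarCoeff, ascPochhammer_succ_eval, Finset.prod_mul_distrib, Nat.factorial_succ]
  push_cast
  rw [mul_div_mul_comm]
  simp only [div_eq_mul_inv, mul_inv, one_mul]
  ring

theorem scalarCoeff_eq_zero {p q : ℕ} {a : Fin p → ℂ} (b : Fin q → ℂ) {j : Fin p} {m : ℕ}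
    (h : a j = -(m : ℂ)) {l : ℕ} (hl : m < l) : scalarCoeff a b l = 0 := by
  rw [scalarCoeff, Finset.prod_eq_zero (Finset.mem_univ j), zero_div, mul_zero]
  rw [h]
  exact ascPochhammer_eval_neg_coe_nat_of_lt hl

theorem tendsto_add_natCast_div (a : ℂ) :
    Filter.Tendsto (fun l : ℕ => (a + l) / ((l : ℂ) + 1)) Filter.atTop (nhds 1) := by
  have h1 : Filter.Tendsto (fun l : ℕ => 1 + (a - 1) * (1 / ((l : ℂ) + 1))) Filter.atTop
      (nhds (1 + (a - 1) * 0)) :=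
    tendsto_const_nhds.add (tendsto_const_nhds.mul (tendsto_one_div_add_atTop_nhds_zero_nat ))
  rw [mul_zero, add_zero] at h1
  refine h1.congr fun l => ?_
  have : (l : ℂ) + 1 ≠ 0 := Nat.cast_add_one_ne_zero l
  field_simp
  ring

/-- Ratio test: the ratio behaves like l^{p-q-1} w. The recursion holds for every b because 0⁻¹ = 0.
-/
theorem summable_scalarCoeff {p q : ℕ} (a : Fin p → ℂ) (b : Fin q → ℂ) {w : ℂ}
    (h : InConvergenceRegion a q w) : Summable fun l => scalarCoeff a b l * w ^ l := by
  by_cases hterm : ∃ j, ∃ m : ℕ, a j = -(m : ℂ)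
  · obtain ⟨j, m, hjm⟩ := hterm
    refine summable_of_ne_finset_zero (s := Finset.range (m + 1)) fun l hl => ?_
    rw [scalarCoeff_eq_zero b hjm (by simpa using hl), zero_mul]
  set R : ℕ → ℂ := fun l => (∏ j, (a j + l)) / ((∏ i, (b i + l)) * (l + 1)) * w with hR
  have hrec : ∀ l, scalarCoeff a b (l + 1) * w ^ (l + 1) = R l * (scalarCoeff a b l * w ^ l) :=
    fun l => by rw [scalarCoeff_succ, hR, pow_succ]; ring
  have hlim : ∃ r : ℝ, r < 1 ∧ Filter.Tendsto (fun l => ‖R l‖) Filter.atTop (nhds r) := by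
    have hA : Filter.Tendsto (fun l : ℕ => (∏ j, ((a j + l) / ((l : ℂ) + 1))) /
        ∏ i, ((b i + l) / ((l : ℂ) + 1))) Filter.atTop (nhds 1) := by
      have h1 := tendsto_finsetProd (Finset.univ : Finset (Fin p)) fun j _ =>
        tendsto_add_natCast_div (a j)
      have h2 := tendsto_finsetProd (Finset.univ : Finset (Fin q)) fun i _ =>
        tendsto_add_natCast_div (b i)
      have h3 := h1.div h2 (by simp)
      simp only [Finset.prod_const_one, div_one] at h3
      exact h3
    have hne : ∀ l : ℕ, (l : ℂ) + 1 ≠ 0 := fun l => Nat.cast_add_one_ne_zero l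
    rcases h with hpq | ⟨hpq, hw⟩ | hj
    · refine ⟨0, zero_lt_one, ?_⟩
      have h1 : Filter.Tendsto (fun l : ℕ => (1 / ((l : ℂ) + 1)) ^ (q + 1 - p)) Filter.atTop
          (nhds 0) := by
        have := (tendsto_one_div_add_atTop_nhds_zero_nat (𝕜 := ℂ)).pow (q + 1 - p)
        rwa [zero_pow (by omega)] at this
      have h2 := ((hA.mul h1).mul_const w).norm
      simp only [mul_zero, zero_mul, norm_zero] at h2
      refine h2.congr fun l => ?_
      simp only [hR, Finset.prod_div_distrib, Finset.prod_const, Finset.card_univ,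
        Fintype.card_fin]
      congr 2
      have h3 : ((l : ℂ) + 1) ^ (q + 1) = ((l : ℂ) + 1) ^ (q + 1 - p) * ((l : ℂ) + 1) ^ p := by
        rw [← pow_add, Nat.sub_add_cancel (by omega)]
      have h4 := hne l
      have h5 : ((l : ℂ) + 1) ^ q * (((l : ℂ) + 1) ^ p)⁻¹ * (((l : ℂ) + 1) ^ (q + 1 - p))⁻¹ =
          ((l : ℂ) + 1)⁻¹ := by
        field_simp
        rw [mul_comm (((l : ℂ) + 1) ^ p), ← h3, pow_succ, mul_comm]
      simp only [div_eq_mul_inv, mul_inv, inv_inv, one_mul, inv_pow]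
      linear_combination (∏ j, (a j + l)) * (∏ i, (b i + l))⁻¹ * h5
    · refine ⟨‖w‖, hw, ?_⟩
      have h2 := (hA.mul_const w).norm
      rw [one_mul] at h2
      refine h2.congr fun l => ?_
      simp only [hR, Finset.prod_div_distrib, Finset.prod_const, Finset.card_univ,
        Fintype.card_fin, hpq]
      congr 2
      have h4 := hne l
      have h5 : ((l : ℂ) + 1) ^ q * (((l : ℂ) + 1) ^ (q + 1))⁻¹ = ((l : ℂ) + 1)⁻¹ := by
        field_simp
        ring
      simp only [div_eq_mul_inv, mul_inv, inv_inv]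
      linear_combination (∏ j, (a j + l)) * (∏ i, (b i + l))⁻¹ * h5
    · exact absurd hj hterm
  obtain ⟨r, hr, hlim⟩ := hlim
  obtain ⟨s, hrs, hs⟩ := exists_between hr
  refine summable_of_ratio_norm_eventually_le hs ?_
  filter_upwards [hlim.eventually_le_const hrs] with l hl
  rw [hrec, norm_mul]
  gcongr

theorem ascPochhammer_eval_eq_prod (z : ℂ) {m n : ℕ} (hm : m ≤ n) :
    (ascPochhammer ℂ m).eval (z - n + 1) = factorialQuotient z (n - m) n := by
  induction m with
  | zero => simp [factorialQuotient]
  | succ m ih =>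
    rw [ascPochhammer_succ_eval, ih (by omega), factorialQuotient, factorialQuotient,
      Finset.prod_eq_prod_Ico_succ_bot (show n - (m + 1) < n by omega), mul_comm,
      show n - (m + 1) + 1 = n - m by omega]
    congr 1
    push_cast [hm]
    ring

/-- The origin of the shift by n - 1: the first n - 1 - i factors starting at a - n + 1 lead up to a
- i, where the i-th factor of the generalized Pochhammer symbol begins. -/
theorem ascPochhammer_stair {n : ℕ} (a : ℂ) (κ : Fin n → ℕ) (i : Fin n) :
    (ascPochhammer ℂ (stair κ i)).eval (a - n + 1) =
      (ascPochhammer ℂ (i.rev : ℕ)).eval (a - n + 1) *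
        (ascPochhammer ℂ (κ i)).eval (a - ((i : ℕ) : ℂ)) := by
  have h : ((i.rev : ℕ) : ℂ) = n - (i + 1) := by
    rw [Fin.val_rev, Nat.cast_sub i.2]
    push_cast
    ring
  rw [show stair κ i = (i.rev : ℕ) + κ i from add_comm _ _, ← ascPochhammer_mul,
    Polynomial.eval_mul, Polynomial.eval_comp]
  congr 2
  rw [Polynomial.eval_add, Polynomial.eval_X, Polynomial.eval_natCast, h]
  ring

theorem prod_scalarCoeff_stair {p q n : ℕ} (a : Fin p → ℂ) (b : Fin q → ℂ) (κ : Fin n → ℕ) :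
    ∏ i, scalarCoeff (fun j => a j - (n : ℂ) + 1) (fun j => b j - (n : ℂ) + 1) (stair κ i) =
      (∏ i : Fin n, scalarCoeff (fun j => a j - (n : ℂ) + 1) (fun j => b j - (n : ℂ) + 1)
        (i.rev : ℕ)) * (((∏ i : Fin n, ((i.rev : ℕ).factorial : ℂ)) /
          ∏ i, ((stair κ i).factorial : ℂ)) *
        ((∏ j, genPochhammer 1 (a j) κ) / ∏ j, genPochhammer 1 (b j) κ)) := by
  have hgen : ∀ {m : ℕ} (d : Fin m → ℂ), ∏ j, genPochhammer 1 (d j) κ =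
      ∏ i : Fin n, ∏ j, (ascPochhammer ℂ (κ i)).eval (d j - ((i : ℕ) : ℂ)) := by
    intro m d
    rw [Finset.prod_comm]
    simp [genPochhammer]
  rw [hgen, hgen, ← Finset.prod_div_distrib, ← Finset.prod_div_distrib, ← Finset.prod_mul_distrib,
    ← Finset.prod_mul_distrib]
  refine Finset.prod_congr rfl fun i _ => ?_
  simp only [scalarCoeff, ascPochhammer_stair, Finset.prod_mul_distrib]
  rw [mul_div_mul_comm]
  have : ((i.rev : ℕ).factorial : ℂ) ≠ 0 := by exact_mod_cast Nat.factorial_ne_zero _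
  field_simp

theorem scalarCoeff_shift {p q n m : ℕ} (a : Fin p → ℂ) (b : Fin q → ℂ) (hm : m ≤ n) :
    scalarCoeff (fun j => a j - (n : ℂ) + 1) (fun j => b j - (n : ℂ) + 1) m =
      ((m.factorial : ℂ) * (∏ i, factorialQuotient (b i) (n - m) n) *
        ∏ j, (factorialQuotient (a j) (n - m) n)⁻¹)⁻¹ := by
  simp only [scalarCoeff, ascPochhammer_eval_eq_prod _ hm, Finset.prod_inv_distrib, mul_inv,
    inv_inv, div_eq_mul_inv, one_mul]
  ring

/-- With ℓ = i + 1, the ℓ-th factor of K is the inverse of the shifted coefficient of index n - ℓ.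
-/
theorem constK_eq {p q n r : ℕ} (hr : r ≤ n) (a : Fin p → ℂ) (b : Fin q → ℂ) :
    constK n r a b = (∏ i : Fin r, scalarCoeff (fun j => a j - (n : ℂ) + 1)
      (fun j => b j - (n : ℂ) + 1) ((Fin.castLE hr i).rev : ℕ))⁻¹ := by
  rw [constK, ← Finset.prod_inv_distrib]
  have h1 : ∀ i : Fin r, (scalarCoeff (fun j => a j - (n : ℂ) + 1)
      (fun j => b j - (n : ℂ) + 1) ((Fin.castLE hr i).rev : ℕ))⁻¹ =
      ((n - (i + 1 : ℕ)).factorial : ℂ) * (∏ k, factorialQuotient (b k) (i + 1) n) *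
        ∏ j, (factorialQuotient (a j) (i + 1) n)⁻¹ := by
    intro i
    have hi := i.2
    rw [scalarCoeff_shift a b (by simp), inv_inv]
    simp only [Fin.val_rev, Fin.val_castLE]
    rw [show n - (n - ((i : ℕ) + 1)) = i + 1 by omega]
  rw [Finset.prod_congr rfl fun i _ => h1 i, Fin.prod_univ_eq_prod_range (fun i =>
    ((n - (i + 1 : ℕ)).factorial : ℂ) * (∏ k, factorialQuotient (b k) (i + 1) n) *
        ∏ j, (factorialQuotient (a j) (i + 1) n)⁻¹), Finset.range_eq_Ico]
  rw [Finset.prod_Ico_add' (fun i => ((n - i : ℕ).factorial : ℂ) *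
    (∏ k, factorialQuotient (b k) i n) * ∏ j, (factorialQuotient (a j) i n)⁻¹) 0 r 1]
  rfl

/-- The factors are a_j - k and b_i - k with 1 ≤ k ≤ n - 1, exactly what the excluded values keep
away from 0. -/
theorem scalarCoeff_shift_ne_zero {p q n m : ℕ} {a : Fin p → ℂ} {b : Fin q → ℂ}
    (ha : ∀ j, ∀ m : ℕ, 1 ≤ m → m < n → a j ≠ (m : ℂ))
    (hb : ∀ i, ∀ m : ℕ, b i ≠ (n : ℂ) - 1 - (m : ℂ)) (hm : m < n) :
    scalarCoeff (fun j => a j - (n : ℂ) + 1) (fun j => b j - (n : ℂ) + 1) m ≠ 0 := by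
  rw [scalarCoeff_shift a b hm.le]
  refine inv_ne_zero (mul_ne_zero (mul_ne_zero (by exact_mod_cast Nat.factorial_ne_zero _) ?_) ?_)
  · refine Finset.prod_ne_zero_iff.2 fun i _ => Finset.prod_ne_zero_iff.2 fun k hk => ?_
    have hk := Finset.mem_Ico.1 hk
    have h1 := hb i (n - 1 - k)
    rw [Nat.cast_sub (by omega), Nat.cast_sub (by omega)] at h1
    rw [sub_ne_zero]
    simpa using h1
  · refine Finset.prod_ne_zero_iff.2 fun j _ => inv_ne_zero (Finset.prod_ne_zero_iff.2 fun k hk => ?_)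
    have hk := Finset.mem_Ico.1 hk
    exact sub_ne_zero.2 (ha j k (by omega) (by omega))

theorem InConvergenceRegion.shift {p n q : ℕ} {a : Fin p → ℂ} {w : ℂ}
    (h : InConvergenceRegion a q w) (hn : 0 < n) :
    InConvergenceRegion (fun j => a j - (n : ℂ) + 1) q w := by
  rcases h with h | h | ⟨j, m, h⟩
  · exact Or.inl h
  · exact Or.inr (Or.inl h)
  · refine Or.inr (Or.inr ⟨j, m + (n - 1), ?_⟩)
    simp only [h]
    rw [Nat.cast_add, Nat.cast_sub (by omega)]
    push_cast
    ring

end Coefficients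

/-! ### The determinant formula -/

section Main

theorem HasSum.of_eq {f g : ℕ → ℂ} {s t : ℂ} (h : HasSum f s) (hf : ∀ k, g k = f k) (ht : t = s) :
    HasSum g t := by
  rwa [ht, funext hf]

/-- The lower left block vanishes and the lower right block is upper triangular. -/
theorem det_eq_of_lower_triangular_block {n r : ℕ} (hr : r ≤ n) (M : Matrix (Fin n) (Fin n) ℂ)
    (h : ∀ i j : Fin n, r ≤ (i : ℕ) → j < i → M i j = 0) :
    M.det = (M.submatrix (Fin.castLE hr) (Fin.castLE hr)).det *
      ∏ i : {i : Fin n // ¬ (i : ℕ) < r}, M i i := by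
  rw [Matrix.twoBlockTriangular_det M (fun i : Fin n => (i : ℕ) < r) fun i hi j hj =>
    h i j (not_lt.1 hi) (Fin.lt_def.2 (hj.trans_le (not_lt.1 hi)))]
  congr 1
  · rw [← Matrix.det_submatrix_equiv_self (Fin.castLEquiv hr)]
    rfl
  · refine Matrix.det_of_isUpperTriangular fun i j hij => ?_
    exact h i j (not_lt.1 i.2) hij

theorem det_pow_rev {r : ℕ} (x : Fin r → ℂ) :
    Matrix.det (Matrix.of fun i j : Fin r => x i ^ (j.rev : ℕ)) =
      ∏ i, ∏ j ∈ Finset.Ioi i, (x i - x j) := by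
  have h := Matrix.det_projVandermonde (fun _ => 1) x
  simp only [one_mul] at h
  rw [← h]
  congr 1
  ext i j
  simp [Matrix.projVandermonde_apply]

open Polynomial in
/-- Evaluation at `x i` for the first indices, and coefficients for the others. -/
noncomputable def evalOrCoeff {n : ℕ} (r : ℕ) (x : Fin n → ℂ) (i : Fin n) : ℂ[X] →ₗ[ℂ] ℂ :=
  if (i : ℕ) < r then leval (x i) else lcoeff ℂ (i.rev : ℕ)

open Polynomial in
theorem evalOrCoeff_of_lt {n r : ℕ} (x : Fin n → ℂ) {i : Fin n} (hi : (i : ℕ) < r) (m : ℕ) :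
    evalOrCoeff r x i (X ^ m) = x i ^ m := by
  simp [evalOrCoeff, hi, leval_apply]

open Polynomial in
theorem evalOrCoeff_of_le {n r : ℕ} (x : Fin n → ℂ) {i : Fin n} (hi : r ≤ (i : ℕ)) (m : ℕ) :
    evalOrCoeff r x i (X ^ m) = if (i.rev : ℕ) = m then 1 else 0 := by
  rw [evalOrCoeff, if_neg (not_lt.2 hi), lcoeff_apply, coeff_X_pow]

-- A row i ≥ r reads the coefficient of index n - 1 - i < n - r, while the zero points contribute a
-- factor X^{n-r}.
open Polynomial in
theorem evalOrCoeff_prod_mul {n r : ℕ} {x : Fin n → ℂ}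
    (hx : ∀ i : Fin n, r ≤ (i : ℕ) → x i = 0) (i : Fin n) (f : ℂ[X]) :
    evalOrCoeff r x i ((∏ s, (X - C (x s))) * f) = 0 := by
  by_cases hi : (i : ℕ) < r
  · rw [evalOrCoeff, if_pos hi, leval_apply, eval_mul, eval_prod,
      Finset.prod_eq_zero (Finset.mem_univ i) (by simp), zero_mul]
  · rw [evalOrCoeff, if_neg hi, lcoeff_apply]
    have h1 : ∏ s, (X - C (x s)) =
        (∏ s ∈ Finset.univ.filter (fun s : Fin n => (s : ℕ) < r), (X - C (x s))) *
          X ^ (n - r) := by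
      rw [← Finset.prod_filter_mul_prod_filter_not Finset.univ fun s : Fin n => (s : ℕ) < r]
      congr 1
      have h2 : ∀ s ∈ Finset.univ.filter (fun s : Fin n => ¬ (s : ℕ) < r),
          (X - C (x s) : ℂ[X]) = X := fun s hs => by
        rw [hx s (not_lt.1 (Finset.mem_filter.1 hs).2), C_0, sub_zero]
      rw [Finset.prod_congr rfl h2, Finset.prod_const]
      congr 1
      have h3 := Finset.card_filter_add_card_filter_not (s := (Finset.univ : Finset (Fin n)))
        fun s : Fin n => (s : ℕ) < r
      have h4 : (Finset.univ.filter fun s : Fin n => (s : ℕ) < r).card = r := by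
        rw [Fin.card_filter_val_lt]
        have := i.2
        omega
      rw [h4, Finset.card_univ, Fintype.card_fin] at h3
      omega
    rw [h1, mul_assoc, mul_left_comm, coeff_X_pow_mul', if_neg]
    have := i.2
    simp only [Fin.val_rev]
    omega

variable {z₀ : ℂ} {γ : Path z₀ z₀} {n : ℕ} {y : Fin n → ℂ}

open Polynomial in
/-- The functionals `f ↦ (2πi)⁻¹ ∮ z ^ k f(z) / ∏ (z - y s) dz` on polynomials. -/
noncomputable def residueFunctional (hγ : PiecewiseC1 γ) (hy : ∀ s, Encloses γ (y s)) (k : ℕ) :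
    ℂ[X] →ₗ[ℂ] ℂ where
  toFun f := 1 / (2 * (Real.pi : ℂ) * Complex.I) *
    contourIntegral γ (fun z => (X ^ k * f).eval z / ∏ s, (z - y s))
  map_add' f g := by
    rw [← mul_add, ← contourIntegral_add hγ
      (continuous_div_prod (fun s t => (hy s).1 t) _ (X ^ k * f).continuous)
      (continuous_div_prod (fun s t => (hy s).1 t) _ (X ^ k * g).continuous)]
    simp only [mul_add, eval_add, add_div]
  map_smul' c f := by
    rw [RingHom.id_apply, smul_eq_mul, mul_left_comm, ← contourIntegral_const_mul c]
    simp only [mul_smul_comm, eval_smul, smul_eq_mul, mul_div_assoc]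

open Polynomial in
theorem residueFunctional_X_pow (hγ : PiecewiseC1 γ) (hy : ∀ s, Encloses γ (y s)) (k m : ℕ) :
    residueFunctional hγ hy k (X ^ m) = 1 / (2 * (Real.pi : ℂ) * Complex.I) *
      contourIntegral γ (fun z => z ^ (k + m) / ∏ s, (z - y s)) := by
  simp [residueFunctional, pow_add]

-- The denominator cancels on the path, leaving the integral of a polynomial.
open Polynomial in
theorem residueFunctional_prod_mul (hγ : PiecewiseC1 γ) (hy : ∀ s, Encloses γ (y s)) (k : ℕ)
    (f : ℂ[X]) : residueFunctional hγ hy k ((∏ s, (X - C (y s))) * f) = 0 := by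
  have h : contourIntegral γ (fun z => (X ^ k * ((∏ s, (X - C (y s))) * f)).eval z /
      ∏ s, (z - y s)) = contourIntegral γ (fun z => (X ^ k * f).eval z) := by
    refine contourIntegral_congr fun t => ?_
    have h0 : ∏ s, (γ t - y s) ≠ 0 :=
      Finset.prod_ne_zero_iff.2 fun s _ => sub_ne_zero.2 ((hy s).1 t)
    simp only [eval_mul, eval_prod, eval_sub, eval_X, eval_C]
    field_simp
  change _ * contourIntegral γ _ = 0
  rw [h, contourIntegral_polynomial hγ, mul_zero]

open Polynomial in
theorem residueFunctional_of_le (hγ : PiecewiseC1 γ) (hy : ∀ s, Encloses γ (y s)) {i j : Fin n}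
    (hij : i ≤ j) : residueFunctional hγ hy (i : ℕ) (X ^ (j.rev : ℕ)) = if i = j then 1 else 0 := by
  have h1 : (i : ℕ) ≤ j := hij
  have h2 := j.2
  rw [residueFunctional_X_pow, contourIntegral_pow_div_prod hγ hy _ _
    (by simp only [Fin.val_rev, Finset.card_univ, Fintype.card_fin]; omega)]
  refine if_congr ?_ rfl rfl
  simp only [Fin.val_rev, Finset.card_univ, Fintype.card_fin, Fin.ext_iff]
  omega

-- On the exponents n - 1 - j the matrix is unitriangular, so the normalizing determinant is 1.
open Polynomial in
theorem det_residueFunctional (hγ : PiecewiseC1 γ) (hy : ∀ s, Encloses γ (y s)) (l : Fin n → ℕ) :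
    Matrix.det (Matrix.of fun i j : Fin n => residueFunctional hγ hy (i : ℕ) (X ^ l j)) =
      schurEval y l := by
  rw [det_functional y (fun i => residueFunctional hγ hy (i : ℕ))
    (fun i f => residueFunctional_prod_mul hγ hy _ f)]
  have : Matrix.det (Matrix.of fun i j : Fin n =>
      residueFunctional hγ hy (i : ℕ) (X ^ (j.rev : ℕ))) = 1 := by
    rw [Matrix.det_of_isLowerTriangular]
    · exact Finset.prod_eq_one fun i _ => by
        rw [Matrix.of_apply, residueFunctional_of_le hγ hy le_rfl, if_pos rfl]
    · intro i j hij
      have : i < j := hij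
      rw [Matrix.of_apply, residueFunctional_of_le hγ hy this.le, if_neg this.ne]
  rw [this, one_mul]

-- The rows i ≥ r are unit vectors, and x_i^{n-r} factors out of each remaining row of the r × r
-- block.
open Polynomial in
theorem det_evalOrCoeff {r : ℕ} (hr : r ≤ n) (x : Fin n → ℂ) :
    Matrix.det (Matrix.of fun i j : Fin n => evalOrCoeff r x i (X ^ (j.rev : ℕ))) =
      (∏ i : Fin r, ∏ j ∈ Finset.Ioi i, (x (Fin.castLE hr i) - x (Fin.castLE hr j))) *
        ∏ j : Fin r, x (Fin.castLE hr j) ^ (n - r) := by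
  rw [det_eq_of_lower_triangular_block hr]
  · have h1 : ∏ i : {i : Fin n // ¬ (i : ℕ) < r}, (Matrix.of fun i j : Fin n =>
        evalOrCoeff r x i (X ^ (j.rev : ℕ))) i i = 1 := Finset.prod_eq_one fun i _ => by
      rw [Matrix.of_apply, evalOrCoeff_of_le x (not_lt.1 i.2), if_pos rfl]
    have h2 : (Matrix.of fun i j : Fin n => evalOrCoeff r x i (X ^ (j.rev : ℕ))).submatrix
        (Fin.castLE hr) (Fin.castLE hr) = Matrix.of fun i j : Fin r =>
          x (Fin.castLE hr i) ^ (n - r) * Matrix.of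
            (fun i j : Fin r => x (Fin.castLE hr i) ^ (j.rev : ℕ)) i j := by
      ext i j
      have hj := j.2
      rw [Matrix.submatrix_apply, Matrix.of_apply, evalOrCoeff_of_lt x i.2, Matrix.of_apply,
        Matrix.of_apply, ← pow_add]
      congr 1
      simp only [Fin.val_rev, Fin.val_castLE]
      omega
    rw [h1, h2, Matrix.det_mul_column, det_pow_rev, mul_one, mul_comm]
  · intro i j hi hji
    rw [Matrix.of_apply, evalOrCoeff_of_le x hi, if_neg]
    intro h
    exact hji.ne (Fin.rev_injective (Fin.ext h)).symm

open Polynomial in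
theorem hasSum_residueFunctional (hγ : PiecewiseC1 γ) (hy : ∀ s, Encloses γ (y s)) (k : ℕ)
    {p q : ℕ} (a : Fin p → ℂ) (b : Fin q → ℂ) {x : ℂ}
    (hx : ∀ t : I, InConvergenceRegion a q (x * γ t)) :
    HasSum (fun l => scalarCoeff a b l * x ^ l * residueFunctional hγ hy k (X ^ l))
      (1 / (2 * (Real.pi : ℂ) * Complex.I) * contourIntegral γ (fun z =>
        scalarPFq a b (x * z) * z ^ k / ∏ s, (z - y s))) := by
  -- Absolute convergence at a point of the path of largest modulus dominates the series along the
  -- whole path.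
  obtain ⟨t₀, -, ht₀⟩ := isCompact_univ.exists_isMaxOn Set.univ_nonempty
    (γ.continuous.norm.continuousOn (s := Set.univ))
  have hs : Summable fun l => ‖scalarCoeff a b l * x ^ l‖ * ‖γ t₀‖ ^ l := by
    refine (summable_scalarCoeff a b (hx t₀)).norm.congr fun l => ?_
    rw [mul_pow, ← mul_assoc, norm_mul, norm_pow]
  have hg := continuous_div_prod (fun s t => (hy s).1 t) Finset.univ (f := fun z => z ^ k)
    (continuous_pow k)
  have h := (hasSum_contourIntegral hγ (fun t => ht₀ (Set.mem_univ t)) hs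
    (g := fun z => z ^ k / ∏ s, (z - y s)) hg).mul_left (1 / (2 * (Real.pi : ℂ) * Complex.I))
  refine h.of_eq (fun l => ?_) ?_
  · rw [residueFunctional_X_pow, mul_left_comm]
    congr 3
    funext z
    rw [add_comm, pow_add, mul_div_assoc]
  · congr 2
    funext z
    rw [mul_div_assoc, scalarPFq]
    congr 1
    refine tsum_congr fun l => ?_
    rw [scalarCoeff, mul_pow]
    ring

open Polynomial in
theorem hasSum_matrixPFqTerm (hγ : PiecewiseC1 γ) (hy : ∀ s, Encloses γ (y s)) {p q r : ℕ}
    (hr : r ≤ n) {a : Fin p → ℂ} {b : Fin q → ℂ}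
    (ha : ∀ j, ∀ m : ℕ, 1 ≤ m → m < n → a j ≠ (m : ℂ))
    (hb : ∀ i, ∀ m : ℕ, b i ≠ (n : ℂ) - 1 - (m : ℂ)) {x : Fin n → ℂ}
    (hx0 : ∀ i : Fin n, r ≤ (i : ℕ) → x i = 0)
    (hx : Function.Injective fun i : Fin r => x (Fin.castLE hr i))
    (hxne : ∀ i : Fin r, x (Fin.castLE hr i) ≠ 0)
    (hconv : ∀ (i : Fin n) (t : I), InConvergenceRegion a q (x i * γ t)) :
    HasSum (matrixPFqTerm 1 a b x y)
      (constK n r a b /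
          ((∏ i : Fin r, ∏ j ∈ Finset.Ioi i, (x (Fin.castLE hr i) - x (Fin.castLE hr j))) *
            ∏ j : Fin r, x (Fin.castLE hr j) ^ (n - r)) *
        Matrix.det (Matrix.of fun i j : Fin r =>
          1 / (2 * (Real.pi : ℂ) * Complex.I) * contourIntegral γ (fun z =>
            scalarPFq (fun l => a l - (n : ℂ) + 1) (fun l => b l - (n : ℂ) + 1)
                (x (Fin.castLE hr i) * z) * z ^ (j : ℕ) / ∏ s : Fin n, (z - y s)))) := by
  set c := scalarCoeff (fun l => a l - (n : ℂ) + 1) (fun l => b l - (n : ℂ) + 1) with hc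
  set φ : Fin n → ℂ[X] →ₗ[ℂ] ℂ := fun k => residueFunctional hγ hy (k : ℕ) with hφ
  set D : ℂ := (∏ i : Fin r, ∏ j ∈ Finset.Ioi i, (x (Fin.castLE hr i) - x (Fin.castLE hr j))) *
    ∏ j : Fin r, x (Fin.castLE hr j) ^ (n - r) with hD
  have hD0 : D ≠ 0 := mul_ne_zero
    (Finset.prod_ne_zero_iff.2 fun i _ => Finset.prod_ne_zero_iff.2 fun j hj =>
      sub_ne_zero.2 fun h => (Finset.mem_Ioi.1 hj).ne (hx h))
    (Finset.prod_ne_zero_iff.2 fun j _ => pow_ne_zero _ (hxne j))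
  have hc0 : ∀ i : Fin n, c (i.rev : ℕ) ≠ 0 := fun i => scalarCoeff_shift_ne_zero ha hb i.rev.2
  have hlt : ∀ i k : Fin n, (i : ℕ) < r →
      HasSum (fun l => c l * evalOrCoeff r x i (X ^ l) * φ k (X ^ l))
      (1 / (2 * (Real.pi : ℂ) * Complex.I) * contourIntegral γ (fun z =>
        scalarPFq (fun l => a l - (n : ℂ) + 1) (fun l => b l - (n : ℂ) + 1) (x i * z) *
          z ^ (k : ℕ) / ∏ s, (z - y s))) := by
    intro i k hi
    simp only [evalOrCoeff_of_lt x hi]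
    exact hasSum_residueFunctional hγ hy k _ _ fun t => (hconv i t).shift (i.pos)
  -- Coefficient extraction leaves the single term l = n - 1 - i.
  have hge : ∀ i k : Fin n, r ≤ (i : ℕ) →
      HasSum (fun l => c l * evalOrCoeff r x i (X ^ l) * φ k (X ^ l))
      (c (i.rev : ℕ) * φ k (X ^ (i.rev : ℕ))) := by
    intro i k hi
    have h := hasSum_single (f := fun l => c l * evalOrCoeff r x i (X ^ l) * φ k (X ^ l))
      (i.rev : ℕ) fun l hl => by
        rw [evalOrCoeff_of_le x hi, if_neg hl.symm, mul_zero, zero_mul]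
    rwa [evalOrCoeff_of_le x hi, if_pos rfl, mul_one] at h
  have hsum : ∀ i k, Summable fun l => ‖c l * evalOrCoeff r x i (X ^ l) * φ k (X ^ l)‖ := by
    intro i k
    rcases lt_or_ge (i : ℕ) r with hi | hi
    · exact (hlt i k hi).summable.norm
    · exact (hge i k hi).summable.norm
  have hCB := hasSum_cauchyBinet c (fun i l => evalOrCoeff r x i (X ^ l))
    (fun k l => φ k (X ^ l)) hsum
  have hdet : Matrix.det (Matrix.of fun i k : Fin n =>
      ∑' l, c l * evalOrCoeff r x i (X ^ l) * φ k (X ^ l)) =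
      Matrix.det (Matrix.of fun i j : Fin r =>
          1 / (2 * (Real.pi : ℂ) * Complex.I) * contourIntegral γ (fun z =>
            scalarPFq (fun l => a l - (n : ℂ) + 1) (fun l => b l - (n : ℂ) + 1)
                (x (Fin.castLE hr i) * z) * z ^ (j : ℕ) / ∏ s : Fin n, (z - y s))) *
        ∏ i : {i : Fin n // ¬ (i : ℕ) < r}, c ((i : Fin n).rev : ℕ) := by
    rw [det_eq_of_lower_triangular_block hr]
    · congr 1
      · congr 1
        ext i j
        rw [Matrix.submatrix_apply, Matrix.of_apply, (hlt _ _ i.2).tsum_eq]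
        rfl
      · refine Finset.prod_congr rfl fun i _ => ?_
        rw [Matrix.of_apply, (hge _ _ (not_lt.1 i.2)).tsum_eq, hφ]
        dsimp only
        rw [residueFunctional_of_le hγ hy le_rfl, if_pos rfl, mul_one]
    · intro i j hi hji
      rw [Matrix.of_apply, (hge _ _ hi).tsum_eq, hφ]
      dsimp only
      rw [residueFunctional_of_le hγ hy hji.le, if_neg hji.ne, mul_zero]
  have hprod : ∏ i : Fin n, c (i.rev : ℕ) =
      (∏ i : Fin r, c ((Fin.castLE hr i).rev : ℕ)) *
        ∏ i : {i : Fin n // ¬ (i : ℕ) < r}, c ((i : Fin n).rev : ℕ) := by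
    rw [← Fintype.prod_subtype_mul_prod_subtype (fun i : Fin n => (i : ℕ) < r),
      ← Equiv.prod_comp (Fin.castLEquiv hr)]
    rfl
  have hP1 : ∏ i : Fin r, c ((Fin.castLE hr i).rev : ℕ) ≠ 0 :=
    Finset.prod_ne_zero_iff.2 fun i _ => hc0 _
  have hP2 : ∏ i : {i : Fin n // ¬ (i : ℕ) < r}, c ((i : Fin n).rev : ℕ) ≠ 0 :=
    Finset.prod_ne_zero_iff.2 fun i _ => hc0 _
  -- Termwise, the two determinants are D · s_κ(x) and s_κ(y), and the product of coefficients
  -- carries the base values c_{n-1-i}; dividing by these and by D leaves the hypergeometric term.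
  refine (hCB.mul_left ((∏ i : Fin n, c (i.rev : ℕ)) * D)⁻¹).of_eq (fun k => ?_) ?_
  · rw [matrixPFqTerm, Finset.mul_sum, Finset.mul_sum]
    refine Finset.sum_congr rfl fun κ hκ => ?_
    obtain ⟨hk, hanti⟩ := mem_partitionsOf.1 hκ
    rw [jackC_one_mul_div hanti, hk, hc, prod_scalarCoeff_stair, ← hc,
      det_functional x (evalOrCoeff r x) (evalOrCoeff_prod_mul hx0), det_evalOrCoeff hr x, ← hD,
      det_residueFunctional hγ hy]
    have h1 : (k.factorial : ℂ) ≠ 0 := by exact_mod_cast Nat.factorial_ne_zero _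
    have h2 : ∏ i : Fin n, c (i.rev : ℕ) ≠ 0 := Finset.prod_ne_zero_iff.2 fun i _ => hc0 i
    rw [mul_inv]
    set A := ∏ i : Fin n, c (i.rev : ℕ)
    set K : ℂ := (k.factorial : ℂ)
    have e1 : A⁻¹ * A = 1 := inv_mul_cancel₀ h2
    have e2 : D⁻¹ * D = 1 := inv_mul_cancel₀ hD0
    have e3 : 1 / K * K = 1 := one_div_mul_cancel h1
    set T := (∏ i : Fin n, ((i.rev : ℕ).factorial : ℂ)) / (∏ i, ((stair κ i).factorial : ℂ)) *
      ((∏ j, genPochhammer 1 (a j) κ) / ∏ j, genPochhammer 1 (b j) κ) *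
      (schurEval x (stair κ) * schurEval y (stair κ)) with hT
    linear_combination T * e3 - T * (D⁻¹ * D) * e1 - T * e2
  -- The base coefficients with i ≥ r cancel the diagonal of the lower block; those with i < r give
  -- K.
  · rw [hdet, constK_eq hr, ← hc, hprod]
    field_simp

end Main

theorem corollary2 {p q n r : ℕ} (hr : r ≤ n)
    (a : Fin p → ℂ) (b : Fin q → ℂ)
    (ha : ∀ j, ∀ m : ℕ, 1 ≤ m → m < n → a j ≠ (m : ℂ))
    (hb : ∀ i, ∀ m : ℕ, b i ≠ (n : ℂ) - 1 - (m : ℂ))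
    (x : Fin n → ℝ) (y : Fin n → ℂ)
    (hx : ∀ i : Fin n, x i ≠ 0 ↔ (i : ℕ) < r)
    (hord : ∀ i j : Fin n, i < j → (j : ℕ) < r → x j < x i)
    (hconv : ∀ i s : Fin n, InConvergenceRegion a q ((x i : ℂ) * y s))
    (z₀ : ℂ) (γ : Path z₀ z₀) (hγ : PiecewiseC1 γ)
    (hγy : ∀ s, Encloses γ (y s))
    (hγconv : ∀ (i : Fin n) (t : unitInterval), InConvergenceRegion a q ((x i : ℂ) * γ t)) :
    Summable (matrixPFqTerm 1 a b (fun i => (x i : ℂ)) y) ∧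
    matrixPFq 1 a b (fun i => (x i : ℂ)) y =
      constK n r a b /
          ((∏ i : Fin r, ∏ j ∈ Finset.Ioi i,
              ((x (Fin.castLE hr i) : ℂ) - (x (Fin.castLE hr j) : ℂ))) *
            ∏ j : Fin r, (x (Fin.castLE hr j) : ℂ) ^ (n - r)) *
        Matrix.det (Matrix.of fun i j : Fin r =>
          1 / (2 * (Real.pi : ℂ) * Complex.I) * contourIntegral γ (fun z =>
            scalarPFq (fun l => a l - (n : ℂ) + 1) (fun l => b l - (n : ℂ) + 1)
                ((x (Fin.castLE hr i) : ℂ) * z) *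
              z ^ (j : ℕ) / ∏ s : Fin n, (z - y s))) := by
  have h := hasSum_matrixPFqTerm (x := fun i => (x i : ℂ)) hγ hγy hr ha hb
    (fun i hi => by
      rw [Complex.ofReal_eq_zero]
      by_contra h0
      exact absurd ((hx i).1 h0) (not_lt.2 hi))
    (by
      intro i j hij
      have hij : x (Fin.castLE hr i) = x (Fin.castLE hr j) := Complex.ofReal_injective hij
      rcases lt_trichotomy i j with h | h | h
      · exact absurd hij (hord _ _ h j.2).ne'
      · exact h
      · exact absurd hij (hord _ _ h i.2).ne)
    (fun i => Complex.ofReal_ne_zero.2 ((hx _).2 i.2)) hγconv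
  -- Unconditional summability in ℂ is absolute convergence.
  exact ⟨h.summable, h.tsum_eq⟩
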